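/- For $p,n\in\mathbb N_0$ with $p\ge 1$ and a root of unity $x$ put $$\zeta_n(p;x)=\sum_{k=1}^n\frac{x^k}{k^p},\qquad t_n(p;x)=\sum_{k=1}^n\frac{x^k}{(k-1/2)^p},\qquad \mathrm{Li}_p(x)=\lim_{n\to\infty}\zeta_n(p;x),\qquad \mathrm{ti}_p(x)=\lim_{n\to\infty}t_n(p;x)\qquad((p,x)\ne(1,1)),$$ and for $p_1,\dots,p_r,q\ge1$ and roots of unity $x_1,\dots,x_r,z$ with $(q,z)\ne(1,1)$ define the cyclotomic Euler $R$-sum $$R_{p_1,\dots,p_r;q}(x_1,\dots,x_r;z)=\sum_{n=0}^\infty\frac{\zeta_n(p_1;x_1)\cdots\zeta_n(p_r;x_r)}{(n+1/2)^q}\,z^n ,$$ where every infinite series is the limit of its ordinary partial sums. **Theorem.** Let $x,x_1,x_2$ be roots of unity and $p_1,p_2,q\ge 1$ integers, put $w=xx_1x_2$, and assume $(p_1,x_1)\ne(1,1)$, $(p_2,x_2)\ne(1,1)$, $(q,w)\neq(1,1)$. For $k\ge 0$ write $$A_k=(-1)^k\mathrm{Li}_{k+1}(x)-\mathrm{Li}_{k+1}(x^{-1}),\qquad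 B_k=(-1)^k\mathrm{ti}_{k+1}(x)-x\,\mathrm{ti}_{k+1}(x^{-1}),$$ where for $x=1$ the differences $A_0$ and $B_0$ (formally $\mathrm{Li}_1(1)-\mathrm{Li}_1(1)$ and $\mathrm{ti}_1(1)-\mathrm{ti}_1(1)$) are read as $0$. Below, $\sum_\sigma$ runs over the two permutations $\sigma$ of $\{1,2\}$. Then all $R$-series occurring in the following formula converge, and $$\begin{aligned} &w^{-1}R_{p_1,p_2;q}(x_1,x_2;w^{-1})+(-1)^{p_1+p_2+q}R_{p_1,p_2;q}(x_1^{-1},x_2^{-1};w)\\ &=-\mathrm{Li}_{p_1}(x_1)\mathrm{Li}_{p_2}(x_2)\,\mathrm{ti}_q(w^{-1}) +w^{-1}\sum_{\sigma}\mathrm{Li}_{p_{\sigma(1)}}(x_{\sigma(1)})R_{p_{\sigma(2)};q}(x_{\sigma(2)};w^{-1})\\ &\quad-(-1)^qw^{-1}\binom{q+p_1+p_2-1}{q-1}\mathrm{ti}_{q+p_1+p_2}(w)\\ &\quad-(-1)^q\sum_{\sigma}\sum_{k=0}^{p_{\sigma(1)}}\binom{k+p_{\sigma(2)}-1}{p_{\sigma(2)}-1}\binom{q+p_{\sigma(1)}-k-1}{q-1}\Big\{w^{-1}(-1)^k\mathrm{Li}_{k+p_{\sigma(2)}}(x_{\sigma(2)})\,\mathrm{ti}_{q+p_{\sigma(1)}-k}(w)\\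 &\qquad\qquad+(-1)^{p_{\sigma(2)}}R_{k+p_{\sigma(2)};\,p_{\sigma(1)}+q-k}(x_{\sigma(2)}^{-1};w)\Big\}\\ &\quad-(-1)^qw^{-1}\sum_{k=0}^{p_1+p_2-1}\binom{q+p_1+p_2-k-2}{q-1}A_k\,\mathrm{ti}_{q+p_1+p_2-k-1}(w)\\ &\quad-(-1)^qw^{-1}\mathrm{Li}_{p_1}(x_1)\mathrm{Li}_{p_2}(x_2)\,\mathrm{ti}_q(w) -(-1)^q\sum_{\sigma}(-1)^{p_{\sigma(2)}}\mathrm{Li}_{p_{\sigma(1)}}(x_{\sigma(1)})R_{p_{\sigma(2)};q}(x_{\sigma(2)}^{-1};w)\\ &\quad-(-1)^q\sum_{\sigma}\ \sum_{\substack{k_1,k_2\ge0\\ k_1+k_2\le p_{\sigma(1)}-1}}\binom{k_2+p_{\sigma(2)}-1}{p_{\sigma(2)}-1}\binom{q+p_{\sigma(1)}-k_1-k_2-2}{q-1}A_{k_1}\\ &\qquad\qquad\times\Big\{w^{-1}(-1)^{k_2}\mathrm{Li}_{k_2+p_{\sigma(2)}}(x_{\sigma(2)})\,\mathrm{ti}_{q+p_{\sigma(1)}-k_1-k_2-1}(w)+(-1)^{p_{\sigma(2)}}R_{k_2+p_{\sigma(2)};\,p_{\sigma(1)}+q-k_1-k_2-1}(x_{\sigma(2)}^{-1};w)\Big\}\\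 &\quad-\sum_{\substack{k_1+k_2+k_3=q-1\\ k_1,k_2,k_3\ge0}}(-1)^{k_2+k_3}\binom{k_2+p_1-1}{p_1-1}\binom{k_3+p_2-1}{p_2-1}B_{k_1}\,w^{-1}\,\mathrm{ti}_{k_2+p_1}(x_1)\,\mathrm{ti}_{k_3+p_2}(x_2). \end{aligned}$$ -/

import Mathlib

open Filter Topology Finset

noncomputable section

namespace CyclotomicEuler

/-- The finite sum `ζ_n(p; x) = ∑_{k=1}^n x^k / k^p`. -/
def zetaSum (n p : ℕ) (x : ℂ) : ℂ :=
  ∑ k ∈ Finset.Icc 1 n, x ^ k / (k : ℂ) ^ p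

/-- The finite sum `t_n(p; x) = ∑_{k=1}^n x^k / (k - 1/2)^p`. -/
def tSum (n p : ℕ) (x : ℂ) : ℂ :=
  ∑ k ∈ Finset.Icc 1 n, x ^ k / ((k : ℂ) - 1 / 2) ^ p

/-- The polylogarithm `Li_p(x) = lim_n ζ_n(p; x)`, for `‖x‖ ≤ 1` and `(p, x) ≠ (1, 1)`.
The limit is taken along the ordinary partial sums, since the series is in general only
conditionally convergent when `p = 1`. -/
def Li (p : ℕ) (x : ℂ) : ℂ :=
  limUnder atTop (fun n : ℕ => zetaSum n p x)

/-- The `t`-polylogarithm `ti_p(x) = lim_n t_n(p; x)`, for `‖x‖ ≤ 1` and `(p, x) ≠ (1, 1)`. -/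
def ti (p : ℕ) (x : ℂ) : ℂ :=
  limUnder atTop (fun n : ℕ => tSum n p x)

/-- The partial sum over `0 ≤ n < N` of the series defining the cyclotomic Euler `R`-sum of
order `r`. -/
def RPartial {r : ℕ} (p : Fin r → ℕ) (x : Fin r → ℂ) (q : ℕ) (z : ℂ) (N : ℕ) : ℂ :=
  ∑ n ∈ Finset.range N, (∏ j, zetaSum n (p j) (x j)) / ((n : ℂ) + 1 / 2) ^ q * z ^ n

/-- The series defining the cyclotomic Euler `R`-sum converges. -/
def RConverges {r : ℕ} (p : Fin r → ℕ) (x : Fin r → ℂ) (q : ℕ) (z : ℂ) : Prop :=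
  ∃ l : ℂ, Tendsto (RPartial p x q z) atTop (𝓝 l)

/-- The cyclotomic Euler `R`-sum
`R_{p_1,…,p_r;q}(x_1,…,x_r;z) = ∑_{n ≥ 0} ζ_n(p_1;x_1) ⋯ ζ_n(p_r;x_r) z^n / (n + 1/2)^q`. -/
def R {r : ℕ} (p : Fin r → ℕ) (x : Fin r → ℂ) (q : ℕ) (z : ℂ) : ℂ :=
  limUnder atTop (RPartial p x q z)

/-- The linear cyclotomic Euler `R`-sum `R_{p;q}(x;z)`. -/
abbrev R₁ (p : ℕ) (x : ℂ) (q : ℕ) (z : ℂ) : ℂ := R ![p] ![x] q z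

/-- The quadratic cyclotomic Euler `R`-sum `R_{p₁,p₂;q}(x₁,x₂;z)`. -/
abbrev R₂ (p₁ p₂ : ℕ) (x₁ x₂ : ℂ) (q : ℕ) (z : ℂ) : ℂ := R ![p₁, p₂] ![x₁, x₂] q z

end CyclotomicEuler

end

open CyclotomicEuler

/-! The formula says that the residues of F(s) = Φ(s) ψ₁(s) ψ₂(s) / (s + 1/2)^q add up to zero,
where Φ(s) = ∑_{m ∈ ℤ} x^m / (s + m) and ψ_j(s) = ∑_{k ≥ 1} x_j^k / (s + k)^{p_j}. At s = j ≥ 0 only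
Φ has a pole and each ψ contributes a tail Li − ζ_j, which gives the sums at w⁻¹. At s = -(i + 1)
all three factors have poles; their Taylor coefficients there are the A_k and combinations of Li and
ζ_i(·; x_j⁻¹), which give the sums at w. At s = -1/2 the residue is the last sum of the formula,
with the B_k.

No contour integral is needed. Truncate Φ to |m| ≤ N + M and each ψ to k ≤ N: F becomes rational,
and `sum_residue_prod` kills the sum of its residues by partial fractions. Residues are coefficients
of formal Laurent series, which makes `truncated_residue_identity` an algebraic identity.

Two limits follow. Letting M → ∞ with N fixed (`residue_identity`), the coefficients of the
symmetrically truncated kernel converge, even for x = 1. Letting N → ∞ (`tendsto_sum_residues`), the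
residues at s ≥ 0 converge by domination, those at s < -N disappear, and completing the ψ's at -N ≤
s ≤ -1 costs O(∑ 1/((N - i)(i + 1))) = o(1). The estimates rest on the O(1/j) tails of
`exists_tail_bound`; Abel summation covers the conditionally convergent case. Finally
`coeff_add_residue_product` expands the residues at negative integers, and the result is divided by
-w. -/

noncomputable section

namespace CyclotomicEuler

/-! ### Formal Laurent expansions and the vanishing of the sum of residues -/

open PowerSeries (X C coeff)

/-- The embedding of power series into Laurent series over `ℂ`. -/
abbrev toLaurent : PowerSeries ℂ →+* LaurentSeries ℂ := HahnSeries.ofPowerSeries ℤ ℂ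

theorem toLaurent_injective : Function.Injective toLaurent :=
  HahnSeries.ofPowerSeries_injective

theorem coeff_toLaurent_C_mul (c : ℂ) (f : LaurentSeries ℂ) (n : ℤ) :
    (toLaurent (C c) * f).coeff n = c * f.coeff n := by
  simp [toLaurent, HahnSeries.ofPowerSeries_C]

theorem coeff_toLaurent_neg_one (f : PowerSeries ℂ) : (toLaurent f).coeff (-1) = 0 := by
  have := PowerSeries.coeff_coe (R := ℂ) f (-1)
  simpa using this

/-- Clearing a pole of order at most d + 1 turns the residue into a Taylor coefficient; every
residue below is computed in this way. -/
theorem coeff_neg_one_of_X_pow_mul {L : LaurentSeries ℂ} {f : PowerSeries ℂ} (d : ℕ)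
    (h : toLaurent X ^ (d + 1) * L = toLaurent f) : L.coeff (-1) = coeff d f := by
  have h1 := congrArg (fun g : LaurentSeries ℂ => g.coeff (d : ℤ)) h
  simp only [toLaurent, LaurentSeries.coeff_coe_powerSeries] at h1
  rw [← h1, ← map_pow, HahnSeries.ofPowerSeries_X_pow]
  have := HahnSeries.coeff_single_mul_add (r := (1 : ℂ)) (x := L) (a := -1) (b := ((d + 1 : ℕ) : ℤ))
  rw [one_mul] at this
  rw [← this]
  congr 1
  push_cast; ring

/-- The Laurent expansion at `s = a` of `1 / (s - b)`. -/
def poleAt (a b : ℂ) : LaurentSeries ℂ := (toLaurent (X + C (a - b)))⁻¹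

theorem toLaurent_X_add_C_ne_zero (c : ℂ) : toLaurent (X + C c) ≠ 0 := by
  rw [Ne, map_eq_zero_iff _ toLaurent_injective]
  intro h
  have := congrArg (coeff 1) h
  simp at this

theorem toLaurent_X_ne_zero : toLaurent X ≠ 0 := by
  simpa only [map_zero, add_zero] using toLaurent_X_add_C_ne_zero 0

theorem poleAt_self (a : ℂ) : poleAt a a = (toLaurent X)⁻¹ := by simp [poleAt]

/-- Partial fractions, with a constant that does not depend on the centre a of the expansion; hence
the identity can be summed over all centres. -/
theorem poleAt_mul_poleAt (a : ℂ) {b c : ℂ} (h : b ≠ c) :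
    poleAt a b * poleAt a c = toLaurent (C (b - c)⁻¹) * (poleAt a b - poleAt a c) := by
  have hb := toLaurent_X_add_C_ne_zero (a - b)
  have hc := toLaurent_X_add_C_ne_zero (a - c)
  have hbc : toLaurent (C (b - c)⁻¹) * (toLaurent (X + C (a - c)) - toLaurent (X + C (a - b))) = 1 := by
    rw [← map_sub, ← map_mul, ← map_one toLaurent]
    congr 1
    have : (X + C (a - c) - (X + C (a - b)) : PowerSeries ℂ) = C (b - c) := by
      rw [add_sub_add_left_eq_sub, ← map_sub]; congr 1; ring
    rw [this, ← map_mul, inv_mul_cancel₀ (sub_ne_zero.2 h), map_one]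
  unfold poleAt
  rw [inv_sub_inv hb hc, mul_div_assoc', hbc, one_div, mul_inv]

/-- The power series expansion of `(X + c)⁻ᵖ` for `c ≠ 0` and `p ≥ 1`. -/
def invPow (c : ℂ) (p : ℕ) : PowerSeries ℂ :=
  PowerSeries.mk fun k => (-1) ^ k * ((k + p - 1).choose (p - 1) : ℂ) / c ^ (k + p)

theorem coeff_invPow (c : ℂ) (p k : ℕ) :
    coeff k (invPow c p) = (-1) ^ k * ((k + p - 1).choose (p - 1) : ℂ) / c ^ (k + p) := by
  simp [invPow]

theorem X_add_C_mul_invPow_one {c : ℂ} (hc : c ≠ 0) : (X + C c) * invPow c 1 = 1 := by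
  ext k
  rw [add_mul, map_add, PowerSeries.coeff_C_mul, coeff_invPow]
  cases k with
  | zero => simp [hc]
  | succ k =>
    rw [PowerSeries.coeff_succ_X_mul, coeff_invPow]
    simp only [PowerSeries.coeff_one]
    simp
    field_simp
    ring

/-- On coefficients this is Pascal's rule. -/
theorem X_add_C_mul_invPow_succ {c : ℂ} (hc : c ≠ 0) (p : ℕ) :
    (X + C c) * invPow c (p + 2) = invPow c (p + 1) := by
  ext k
  rw [add_mul, map_add, PowerSeries.coeff_C_mul, coeff_invPow, coeff_invPow]
  cases k with
  | zero => simp; field_simp; ring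
  | succ k =>
    rw [PowerSeries.coeff_succ_X_mul, coeff_invPow]
    have e1 : k + 1 + (p + 2) - 1 = (k + p + 1) + 1 := by omega
    have e2 : p + 2 - 1 = p + 1 := by omega
    have e3 : k + 1 + (p + 1) - 1 = k + p + 1 := by omega
    have e4 : k + (p + 2) - 1 = k + p + 1 := by omega
    rw [e1, e2, e3, e4, Nat.choose_succ_succ' (k + p + 1) p]
    simp only [Nat.add_sub_cancel]
    push_cast
    field_simp
    ring

theorem X_add_C_pow_mul_invPow {c : ℂ} (hc : c ≠ 0) {p : ℕ} (hp : 1 ≤ p) :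
    (X + C c) ^ p * invPow c p = 1 := by
  obtain ⟨p, rfl⟩ := Nat.exists_eq_add_of_le' hp
  induction p with
  | zero => simpa using X_add_C_mul_invPow_one hc
  | succ p ih =>
    rw [pow_succ, mul_assoc, X_add_C_mul_invPow_succ hc, ih (by omega)]

theorem poleAt_pow {a b : ℂ} (h : a ≠ b) {p : ℕ} (hp : 1 ≤ p) :
    poleAt a b ^ p = toLaurent (invPow (a - b) p) := by
  have := congrArg toLaurent (X_add_C_pow_mul_invPow (sub_ne_zero.2 h) hp)
  rw [map_mul, map_pow, map_one] at this
  rw [poleAt, inv_pow]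
  exact (eq_inv_of_mul_eq_one_right this).symm

/-- The residues of `∏ 1 / (s - b)`, a product over a nonempty multiset of poles, add up to `1` or
`0` according as there is a single factor or not. -/
theorem sum_residue_prod (P : Finset ℂ) (n : ℕ) :
    ∀ M : Multiset ℂ, M.card = n + 1 → (∀ b ∈ M, b ∈ P) →
      ∑ a ∈ P, ((M.map (poleAt a)).prod).coeff (-1) = if n = 0 then 1 else 0 := by
  induction n with
  | zero =>
    intro M hM hP
    obtain ⟨b, rfl⟩ := Multiset.card_eq_one.1 hM
    have hb : b ∈ P := hP b (by simp)
    rw [Finset.sum_eq_single_of_mem b hb]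
    · simp only [Multiset.map_singleton, Multiset.prod_singleton, if_true, poleAt_self]
      rw [coeff_neg_one_of_X_pow_mul (f := 1) 0]
      · simp
      · rw [zero_add, pow_one, mul_inv_cancel₀ toLaurent_X_ne_zero, map_one]
    · intro a _ hab
      have := poleAt_pow hab le_rfl
      rw [pow_one] at this
      simp only [Multiset.map_singleton, Multiset.prod_singleton, this, coeff_toLaurent_neg_one]
  | succ n ih =>
    intro M hM hP
    rw [if_neg (Nat.succ_ne_zero n)]
    -- Two distinct poles are separated by partial fractions; the two shorter products have equal
    -- residue sums (both 1 or both 0), which cancel. Otherwise the product is a pure power of order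
    -- at least 2, which has no residue.
    by_cases hall : ∃ b ∈ M, ∃ c ∈ M, b ≠ c
    · obtain ⟨b, hb, c, hc, hbc⟩ := hall
      obtain ⟨M₁, rfl⟩ := Multiset.exists_cons_of_mem hb
      have hc' : c ∈ M₁ := (Multiset.mem_cons.1 hc).resolve_left (Ne.symm hbc)
      obtain ⟨M₂, rfl⟩ := Multiset.exists_cons_of_mem hc'
      have h1 := ih (b ::ₘ M₂) (by simpa using hM) (fun d hd => hP d (by
        simp only [Multiset.mem_cons] at hd ⊢; tauto))
      have h2 := ih (c ::ₘ M₂) (by simpa using hM) (fun d hd => hP d (by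
        simp only [Multiset.mem_cons] at hd ⊢; tauto))
      have key : ∀ a, (((b ::ₘ c ::ₘ M₂).map (poleAt a)).prod).coeff (-1) =
          (b - c)⁻¹ * ((((b ::ₘ M₂).map (poleAt a)).prod).coeff (-1)
            - (((c ::ₘ M₂).map (poleAt a)).prod).coeff (-1)) := by
        intro a
        simp only [Multiset.map_cons, Multiset.prod_cons]
        rw [← mul_assoc, poleAt_mul_poleAt a hbc, mul_assoc, coeff_toLaurent_C_mul, sub_mul,
          HahnSeries.coeff_sub]
      simp only [key]
      rw [← Finset.mul_sum, Finset.sum_sub_distrib, h1, h2, sub_self, mul_zero]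
    · push Not at hall
      obtain ⟨b, hb⟩ := Multiset.card_pos_iff_exists_mem.1 (by omega : 0 < M.card)
      have hrep : M = Multiset.replicate (n + 2) b :=
        Multiset.eq_replicate.2 ⟨hM, fun c hc => hall c hc b hb⟩
      subst hrep
      refine Finset.sum_eq_zero fun a _ => ?_
      rw [Multiset.map_replicate, Multiset.prod_replicate]
      by_cases hab : a = b
      · subst hab
        rw [poleAt_self, coeff_neg_one_of_X_pow_mul (f := 1) (n + 1)]
        · simp
        · rw [← mul_pow, mul_inv_cancel₀ toLaurent_X_ne_zero, one_pow, map_one]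
      · rw [poleAt_pow hab (by omega), coeff_toLaurent_neg_one]

/-- The Laurent expansion at `s = a` of `∑_{k ∈ I} x^k / (s + k)^p`. -/
def locSum (I : Finset ℤ) (p : ℕ) (x a : ℂ) : LaurentSeries ℂ :=
  ∑ k ∈ I, toLaurent (C (x ^ k)) * poleAt a (-k) ^ p

/-- Expanding the product gives terms with 1 + p₁ + p₂ + q ≥ 2 linear factors in the denominator, to
which `sum_residue_prod` applies one by one. -/
theorem sum_residue_locSum (P : Finset ℂ) (I I₁ I₂ : Finset ℤ) (x x₁ x₂ : ℂ) (p₁ p₂ q : ℕ) (b : ℂ)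
    (hq : 1 ≤ q) (hb : b ∈ P) (hI : ∀ k ∈ I, -(k : ℂ) ∈ P) (h₁ : ∀ k ∈ I₁, -(k : ℂ) ∈ P)
    (h₂ : ∀ k ∈ I₂, -(k : ℂ) ∈ P) :
    ∑ a ∈ P, (locSum I 1 x a * locSum I₁ p₁ x₁ a * locSum I₂ p₂ x₂ a * poleAt a b ^ q).coeff (-1)
      = 0 := by
  have key : ∀ a, (locSum I 1 x a * locSum I₁ p₁ x₁ a * locSum I₂ p₂ x₂ a
      * poleAt a b ^ q).coeff (-1) = ∑ m ∈ I, ∑ k ∈ I₁, ∑ l ∈ I₂, x ^ m * x₁ ^ k * x₂ ^ l *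
        ((((-(m : ℂ)) ::ₘ (Multiset.replicate p₁ (-(k : ℂ)) + Multiset.replicate p₂ (-(l : ℂ))
          + Multiset.replicate q b)).map (poleAt a)).prod).coeff (-1) := by
    intro a
    simp only [locSum]
    rw [Finset.sum_mul_sum, Finset.sum_mul, Finset.sum_mul, HahnSeries.coeff_sum]
    refine Finset.sum_congr rfl fun m _ => ?_
    rw [Finset.sum_mul, Finset.sum_mul, HahnSeries.coeff_sum]
    refine Finset.sum_congr rfl fun k _ => ?_
    rw [Finset.mul_sum, Finset.sum_mul, HahnSeries.coeff_sum]
    refine Finset.sum_congr rfl fun l _ => ?_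
    rw [← coeff_toLaurent_C_mul]
    congr 1
    simp only [Multiset.map_cons, Multiset.prod_cons, Multiset.map_add, Multiset.prod_add,
      Multiset.map_replicate, Multiset.prod_replicate, map_mul]
    ring
  simp only [key]
  rw [Finset.sum_comm]
  refine Finset.sum_eq_zero fun m hm => ?_
  rw [Finset.sum_comm]
  refine Finset.sum_eq_zero fun k hk => ?_
  rw [Finset.sum_comm]
  refine Finset.sum_eq_zero fun l hl => ?_
  rw [← Finset.mul_sum, sum_residue_prod P (p₁ + p₂ + q), if_neg (by omega), mul_zero]
  · simp
  · intro c hc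
    simp only [Multiset.mem_cons, Multiset.mem_add, Multiset.mem_replicate] at hc
    rcases hc with rfl | (⟨_, rfl⟩ | ⟨_, rfl⟩) | ⟨_, rfl⟩
    exacts [hI m hm, h₁ k hk, h₂ l hl, hb]

/-! ### Reindexing of sums over integer intervals -/

theorem sum_Icc_erase (f : ℤ → ℂ) (n : ℤ) (lo hi : ℕ) :
    ∑ m ∈ (Finset.Icc (n - lo) (n + hi)).erase n, f m
      = ∑ l ∈ Finset.Icc 1 hi, f (n + l) + ∑ l ∈ Finset.Icc 1 lo, f (n - l) := by
  induction hi with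
  | zero =>
    induction lo with
    | zero => simp
    | succ lo ih =>
      have : (Finset.Icc (n - (lo + 1 : ℕ)) (n + (0 : ℕ))).erase n
          = insert (n - (lo + 1 : ℕ)) ((Finset.Icc (n - lo) (n + (0 : ℕ))).erase n) := by
        ext m; simp only [Finset.mem_erase, Finset.mem_Icc, Finset.mem_insert]; omega
      rw [this, Finset.sum_insert (by simp; omega), ih, Finset.sum_Icc_succ_top (by omega)]
      ring
  | succ hi ih =>
    have : (Finset.Icc (n - lo) (n + (hi + 1 : ℕ))).erase n
        = insert (n + (hi + 1 : ℕ)) ((Finset.Icc (n - lo) (n + hi)).erase n) := by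
      ext m; simp only [Finset.mem_erase, Finset.mem_Icc, Finset.mem_insert]; omega
    rw [this, Finset.sum_insert (by simp), ih, Finset.sum_Icc_succ_top (by omega)]
    ring

theorem sum_Icc_symm (f : ℤ → ℂ) (M : ℕ) :
    ∑ m ∈ Finset.Icc (-M : ℤ) M, f m
      = f 0 + (∑ l ∈ Finset.Icc 1 M, f l + ∑ l ∈ Finset.Icc 1 M, f (-l)) := by
  have := sum_Icc_erase f 0 M M
  simp only [zero_sub, zero_add] at this
  rw [← this, Finset.add_sum_erase _ _ (by simp)]

theorem sum_Icc_one_eq_range (f : ℕ → ℂ) (N : ℕ) :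
    ∑ l ∈ Finset.Icc 1 N, f l = ∑ i ∈ Finset.range N, f (i + 1) := by
  induction N with
  | zero => simp
  | succ N ih => rw [Finset.sum_Icc_succ_top (by omega), Finset.sum_range_succ, ih]

theorem sum_Icc_one_cast (f : ℤ → ℂ) (N : ℕ) :
    ∑ m ∈ Finset.Icc (1 : ℤ) N, f m = ∑ l ∈ Finset.Icc 1 N, f l := by
  have := sum_Icc_erase f 0 0 N
  simp only [zero_add, Nat.cast_zero, sub_zero] at this
  rw [show (Finset.Icc (1 : ℤ) N) = (Finset.Icc (0 : ℤ) N).erase 0 by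
    ext m; simp only [Finset.mem_erase, Finset.mem_Icc]; omega, this]
  simp

theorem sum_Icc_one_cast_reflect (f : ℤ → ℂ) (N : ℕ) :
    ∑ m ∈ Finset.Icc (1 : ℤ) N, f m = ∑ l ∈ Finset.Icc 1 N, f (N + 1 - l) := by
  have := sum_Icc_erase f (N + 1) N 0
  rw [show (Finset.Icc (1 : ℤ) N)
      = (Finset.Icc ((N : ℤ) + 1 - N) ((N : ℤ) + 1 + (0 : ℕ))).erase (N + 1) by
    ext m; simp only [Finset.mem_erase, Finset.mem_Icc]; omega, this]
  simp

theorem zetaSum_succ (n p : ℕ) (x : ℂ) :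
    zetaSum (n + 1) p x = zetaSum n p x + x ^ (n + 1) / ((n + 1 : ℕ) : ℂ) ^ p := by
  rw [zetaSum, Finset.sum_Icc_succ_top (by omega), zetaSum]

theorem tSum_succ (n p : ℕ) (x : ℂ) :
    tSum (n + 1) p x = tSum n p x + x ^ (n + 1) / (((n + 1 : ℕ) : ℂ) - 1 / 2) ^ p := by
  rw [tSum, Finset.sum_Icc_succ_top (by omega), tSum]

theorem zetaSum_zero (p : ℕ) (x : ℂ) : zetaSum 0 p x = 0 := by simp [zetaSum]

theorem tSum_zero (p : ℕ) (x : ℂ) : tSum 0 p x = 0 := by simp [tSum]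

theorem zetaSum_add_sub (j N p : ℕ) (x : ℂ) :
    zetaSum (j + N) p x - zetaSum j p x
      = ∑ l ∈ Finset.Icc 1 N, x ^ (j + l) / ((j + l : ℕ) : ℂ) ^ p := by
  induction N with
  | zero => simp
  | succ N ih =>
    rw [Finset.sum_Icc_succ_top (by omega), ← ih, ← add_assoc, zetaSum_succ]
    ring

/-! ### Local expansions of the truncated kernel and of the truncated ψ's -/

/-- The regular part at `s = -n` of `x⁻ⁿ ∑_{k ∈ I} x^k / (s + k)^p`. -/
def reg (I : Finset ℤ) (p : ℕ) (x : ℂ) (n : ℤ) : PowerSeries ℂ :=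
  ∑ k ∈ I.erase n, C (x ^ (k - n)) * invPow (k - n) p

/-- The expansion at `s = -1/2` of `∑_{k ∈ I} x^k / (s + k)^p`. -/
def halfExp (I : Finset ℤ) (p : ℕ) (x : ℂ) : PowerSeries ℂ :=
  ∑ k ∈ I, C (x ^ k) * invPow (k - 1 / 2) p

theorem sum_erase_poleAt (I : Finset ℤ) {p : ℕ} (hp : 1 ≤ p) {x : ℂ} (hx : x ≠ 0) (n : ℤ) :
    ∑ k ∈ I.erase n, toLaurent (C (x ^ k)) * poleAt (-n) (-k) ^ p
      = toLaurent (C (x ^ n) * reg I p x n) := by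
  rw [reg, Finset.mul_sum, map_sum]
  refine Finset.sum_congr rfl fun k hk => ?_
  have hkn : (-(n : ℂ)) ≠ -(k : ℂ) := by
    intro h
    exact (Finset.mem_erase.1 hk).1 (by exact_mod_cast (neg_injective h).symm)
  rw [poleAt_pow hkn hp, ← mul_assoc, ← map_mul C, ← zpow_add₀ hx, map_mul]
  rw [show n + (k - n) = k by ring, show -(n : ℂ) - -(k : ℂ) = k - n by ring]

theorem locSum_neg_of_notMem {I : Finset ℤ} {p : ℕ} (hp : 1 ≤ p) {x : ℂ} (hx : x ≠ 0) {n : ℤ}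
    (hn : n ∉ I) : locSum I p x (-n) = toLaurent (C (x ^ n) * reg I p x n) := by
  rw [← sum_erase_poleAt I hp hx n, Finset.erase_eq_of_notMem hn, locSum]

/-- The factor x^n is pulled out so that, at a common pole of the three sums, these factors combine
to w^n. -/
theorem X_pow_mul_locSum_neg {I : Finset ℤ} {p : ℕ} (hp : 1 ≤ p) {x : ℂ} (hx : x ≠ 0) {n : ℤ}
    (hn : n ∈ I) :
    toLaurent X ^ p * locSum I p x (-n)
      = toLaurent (C (x ^ n) * (1 + X ^ p * reg I p x n)) := by
  rw [locSum, ← Finset.add_sum_erase _ _ hn, sum_erase_poleAt I hp hx n, poleAt_self, mul_add,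
    inv_pow, mul_left_comm, mul_inv_cancel₀ (pow_ne_zero _ toLaurent_X_ne_zero)]
  simp only [map_mul, map_add, map_one, map_pow]
  ring

theorem intCast_sub_half_ne_zero (k : ℤ) : (k : ℂ) - 1 / 2 ≠ 0 := by
  intro h
  have h1 : (2 * k : ℂ) = 1 := by linear_combination 2 * h
  have h2 : (2 * k : ℤ) = 1 := by exact_mod_cast h1
  omega

theorem locSum_half (I : Finset ℤ) {p : ℕ} (hp : 1 ≤ p) (x : ℂ) :
    locSum I p x (-1 / 2) = toLaurent (halfExp I p x) := by
  rw [locSum, halfExp, map_sum]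
  refine Finset.sum_congr rfl fun k _ => ?_
  have h := intCast_sub_half_ne_zero k
  rw [poleAt_pow (fun e => h (by linear_combination e)) hp, map_mul]
  congr 3
  ring

theorem poleAt_neg_half (n : ℤ) {q : ℕ} (hq : 1 ≤ q) :
    poleAt (-n) (-1 / 2) ^ q = toLaurent (invPow (1 / 2 - n) q) := by
  have h := intCast_sub_half_ne_zero n
  rw [poleAt_pow (fun e => h (by linear_combination -e)) hq]
  congr 2
  ring

/-- Indices n + l give the sum in x; indices n - l give the sum in x⁻¹, with the sign of (-l)^(k+p).
-/
theorem coeff_reg_Icc (n : ℤ) (lo hi p k : ℕ) (x : ℂ) :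
    coeff k (reg (Finset.Icc (n - lo) (n + hi)) p x n) = (-1) ^ k * ((k + p - 1).choose (p - 1) : ℂ)
      * (zetaSum hi (k + p) x + (-1) ^ (k + p) * zetaSum lo (k + p) x⁻¹) := by
  simp only [reg, map_sum, PowerSeries.coeff_C_mul, coeff_invPow]
  rw [sum_Icc_erase (fun m => x ^ (m - n) * ((-1) ^ k * ((k + p - 1).choose (p - 1) : ℂ)
    / ((m : ℂ) - n) ^ (k + p)))]
  rw [zetaSum, zetaSum, mul_add, Finset.mul_sum, Finset.mul_sum, Finset.mul_sum]
  congr 1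
  · refine Finset.sum_congr rfl fun l _ => ?_
    push_cast
    rw [add_sub_cancel_left, add_sub_cancel_left, zpow_natCast]
    ring
  · refine Finset.sum_congr rfl fun l _ => ?_
    push_cast
    rw [show n - (l : ℤ) - n = -l by ring, show (n : ℂ) - l - n = -l by ring, zpow_neg, zpow_natCast,
      neg_pow (l : ℂ), inv_pow]
    have : ((-1 : ℂ) ^ (k + p))⁻¹ = (-1) ^ (k + p) := by
      rw [← inv_pow]; norm_num
    rw [div_eq_mul_inv, mul_inv, this]
    ring

/-- At s = j ≥ 0 the denominators j + 1, …, j + N form a block of the zeta sum. `coeff_zero_reg_gt`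
is the mirror image for s < -N, where reflection inverts x and brings the sign (-1)^p. -/
theorem coeff_zero_reg_neg (j N p : ℕ) (x : ℂ) :
    coeff 0 (reg (Finset.Icc 1 (N : ℤ)) p x (-j)) = zetaSum (j + N) p x - zetaSum j p x := by
  rw [reg, Finset.erase_eq_of_notMem (by simp; omega), zetaSum_add_sub]
  simp only [map_sum, PowerSeries.coeff_C_mul, coeff_invPow]
  rw [sum_Icc_one_cast (fun k => x ^ (k - -(j : ℤ)) * ((-1) ^ 0 * ((0 + p - 1).choose (p - 1) : ℂ)
    / ((k : ℂ) - ((-j : ℤ) : ℂ)) ^ (0 + p)))]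
  refine Finset.sum_congr rfl fun l _ => ?_
  rw [show (l : ℤ) - -(j : ℤ) = ((j + l : ℕ) : ℤ) by push_cast; ring, zpow_natCast]
  simp
  rw [add_comm (l : ℂ)]
  ring

theorem coeff_zero_reg_gt (i N p : ℕ) (x : ℂ) :
    coeff 0 (reg (Finset.Icc 1 (N : ℤ)) p x (N + 1 + i))
      = (-1) ^ p * (zetaSum (i + N) p x⁻¹ - zetaSum i p x⁻¹) := by
  rw [reg, Finset.erase_eq_of_notMem (by simp; omega), zetaSum_add_sub]
  simp only [map_sum, PowerSeries.coeff_C_mul, coeff_invPow]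
  rw [sum_Icc_one_cast_reflect (fun k => x ^ (k - ((N : ℤ) + 1 + i)) *
    ((-1) ^ 0 * ((0 + p - 1).choose (p - 1) : ℂ)
    / ((k : ℂ) - (((N : ℤ) + 1 + i : ℤ) : ℂ)) ^ (0 + p))), Finset.mul_sum]
  refine Finset.sum_congr rfl fun l _ => ?_
  rw [show (N : ℤ) + 1 - l - (N + 1 + i) = -((i + l : ℕ) : ℤ) by push_cast; ring, zpow_neg,
    zpow_natCast]
  have h2 : ((((N : ℤ) + 1 - l : ℤ) : ℂ) - (((N : ℤ) + 1 + i : ℤ) : ℂ))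
      = -((i + l : ℕ) : ℂ) := by push_cast; ring
  rw [h2, neg_pow _ (0 + p)]
  have : ((-1 : ℂ) ^ (0 + p) * ((i + l : ℕ) : ℂ) ^ (0 + p))⁻¹
      = (-1) ^ p * (((i + l : ℕ) : ℂ) ^ p)⁻¹ := by
    rw [zero_add, mul_inv, ← inv_pow (-1 : ℂ)]; norm_num
  rw [div_eq_mul_inv, this]
  simp only [zero_add, Nat.choose_self, pow_zero, Nat.cast_one, mul_one, inv_pow]
  ring

theorem coeff_halfExp_Icc_one (N p k : ℕ) (x : ℂ) :
    coeff k (halfExp (Finset.Icc 1 (N : ℤ)) p x)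
      = (-1) ^ k * ((k + p - 1).choose (p - 1) : ℂ) * tSum N (k + p) x := by
  simp only [halfExp, map_sum, PowerSeries.coeff_C_mul, coeff_invPow]
  rw [sum_Icc_one_cast (fun m => x ^ m * ((-1) ^ k * ((k + p - 1).choose (p - 1) : ℂ)
    / ((m : ℂ) - 1 / 2) ^ (k + p))), tSum, Finset.mul_sum]
  refine Finset.sum_congr rfl fun l _ => ?_
  push_cast
  rw [zpow_natCast]
  ring

/-- Half-integers are not symmetric about the index 0: for l ≥ 0, -l - 1/2 = -((l + 1) - 1/2) and
x^(-l) = x · x^(-(l+1)). So the indices m ≤ 0, including m = 0, give M + 1 terms in x⁻¹ with an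
extra factor x. -/
theorem coeff_halfExp_symm (M k : ℕ) {x : ℂ} (hx : x ≠ 0) :
    coeff k (halfExp (Finset.Icc (-M : ℤ) M) 1 x)
      = (-1) ^ k * tSum M (k + 1) x - x * tSum (M + 1) (k + 1) x⁻¹ := by
  simp only [halfExp, map_sum, PowerSeries.coeff_C_mul, coeff_invPow]
  rw [sum_Icc_symm (fun m => x ^ m * ((-1) ^ k * ((k + 1 - 1).choose (1 - 1) : ℂ)
    / ((m : ℂ) - 1 / 2) ^ (k + 1)))]
  have h1 : ∑ l ∈ Finset.Icc 1 M, x ^ (l : ℤ) * ((-1) ^ k * ((k + 1 - 1).choose (1 - 1) : ℂ)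
      / (((l : ℤ) : ℂ) - 1 / 2) ^ (k + 1)) = (-1) ^ k * tSum M (k + 1) x := by
    rw [tSum, Finset.mul_sum]
    refine Finset.sum_congr rfl fun l _ => ?_
    simp
    ring
  have h2 : ∀ M : ℕ, x ^ (0 : ℤ) * ((-1) ^ k * ((k + 1 - 1).choose (1 - 1) : ℂ)
      / (((0 : ℤ) : ℂ) - 1 / 2) ^ (k + 1))
      + ∑ l ∈ Finset.Icc 1 M, x ^ (-l : ℤ) * ((-1) ^ k * ((k + 1 - 1).choose (1 - 1) : ℂ)
      / (((-l : ℤ) : ℂ) - 1 / 2) ^ (k + 1)) = - (x * tSum (M + 1) (k + 1) x⁻¹) := by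
    have hs : ∀ c : ℂ, (-1) ^ k / (-c) ^ (k + 1) = - (1 / c ^ (k + 1)) := by
      intro c
      rw [neg_pow c, pow_succ (-1 : ℂ) k, mul_neg_one, neg_mul, div_neg, ← div_div,
        div_self (pow_ne_zero _ (by norm_num))]
    intro M
    induction M with
    | zero =>
      have := hs (1 / 2)
      rw [tSum_succ, tSum_zero]
      norm_num at this ⊢
      rw [this, mul_div_assoc', mul_inv_cancel₀ hx]
      norm_num
    | succ M ih =>
      rw [Finset.sum_Icc_succ_top (by omega), ← add_assoc, ih, tSum_succ (M + 1)]
      have e : ((-((M + 1 : ℕ) : ℤ) : ℤ) : ℂ) - 1 / 2 = -(((M + 1 + 1 : ℕ) : ℂ) - 1 / 2) := by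
        push_cast; ring
      rw [e]
      have e2 : ((k + 1 - 1).choose (1 - 1) : ℂ) = 1 := by simp
      rw [e2, mul_one, hs, zpow_neg, zpow_natCast, pow_succ x⁻¹ (M + 1), inv_pow]
      field_simp
      ring
  rw [h1, ← add_assoc, add_right_comm, h2 M]
  ring

/-! ### The residues of the truncated function -/

/-- All three sums have a pole here, of total order 1 + p₁ + p₂, while 1/(s + 1/2)^q is regular. -/
theorem residue_of_mem {I I₁ I₂ : Finset ℤ} {n : ℤ} (hn : n ∈ I) (h₁ : n ∈ I₁) (h₂ : n ∈ I₂)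
    {x x₁ x₂ : ℂ} (hx : x ≠ 0) (hx₁ : x₁ ≠ 0) (hx₂ : x₂ ≠ 0) {p₁ p₂ q : ℕ} (hp₁ : 1 ≤ p₁)
    (hp₂ : 1 ≤ p₂) (hq : 1 ≤ q) :
    (locSum I 1 x (-n) * locSum I₁ p₁ x₁ (-n) * locSum I₂ p₂ x₂ (-n)
      * poleAt (-n) (-1 / 2) ^ q).coeff (-1) = (x * x₁ * x₂) ^ n * coeff (p₁ + p₂)
        ((1 + X * reg I 1 x n) * (1 + X ^ p₁ * reg I₁ p₁ x₁ n) * (1 + X ^ p₂ * reg I₂ p₂ x₂ n)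
          * invPow (1 / 2 - n) q) := by
  rw [← PowerSeries.coeff_C_mul]
  apply coeff_neg_one_of_X_pow_mul
  have h := X_pow_mul_locSum_neg le_rfl hx hn
  have h1 := X_pow_mul_locSum_neg hp₁ hx₁ h₁
  have h2 := X_pow_mul_locSum_neg hp₂ hx₂ h₂
  rw [poleAt_neg_half n hq]
  calc _ = (toLaurent X ^ 1 * locSum I 1 x (-n)) * (toLaurent X ^ p₁ * locSum I₁ p₁ x₁ (-n))
        * (toLaurent X ^ p₂ * locSum I₂ p₂ x₂ (-n)) * toLaurent (invPow (1 / 2 - n) q) := by ring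
    _ = _ := by
      rw [h, h1, h2, mul_zpow, mul_zpow]
      simp only [map_mul, pow_one]
      ring

/-- Only the kernel has a pole, and it is simple; the other factors are just evaluated at s = -n. -/
theorem residue_of_notMem {I I₁ I₂ : Finset ℤ} {n : ℤ} (hn : n ∈ I) (h₁ : n ∉ I₁) (h₂ : n ∉ I₂)
    {x x₁ x₂ : ℂ} (hx : x ≠ 0) (hx₁ : x₁ ≠ 0) (hx₂ : x₂ ≠ 0) {p₁ p₂ q : ℕ} (hp₁ : 1 ≤ p₁)
    (hp₂ : 1 ≤ p₂) (hq : 1 ≤ q) :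
    (locSum I 1 x (-n) * locSum I₁ p₁ x₁ (-n) * locSum I₂ p₂ x₂ (-n)
      * poleAt (-n) (-1 / 2) ^ q).coeff (-1) = (x * x₁ * x₂) ^ n *
        (coeff 0 (reg I₁ p₁ x₁ n) * coeff 0 (reg I₂ p₂ x₂ n) / (1 / 2 - n) ^ q) := by
  have key : (locSum I 1 x (-n) * locSum I₁ p₁ x₁ (-n) * locSum I₂ p₂ x₂ (-n)
      * poleAt (-n) (-1 / 2) ^ q).coeff (-1) = coeff 0 (C ((x * x₁ * x₂) ^ n) *
        ((1 + X * reg I 1 x n) * reg I₁ p₁ x₁ n * reg I₂ p₂ x₂ n * invPow (1 / 2 - n) q)) := by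
    apply coeff_neg_one_of_X_pow_mul
    have h := X_pow_mul_locSum_neg le_rfl hx hn
    rw [poleAt_neg_half n hq, locSum_neg_of_notMem hp₁ hx₁ h₁, locSum_neg_of_notMem hp₂ hx₂ h₂,
      ← mul_assoc, ← mul_assoc, ← mul_assoc, zero_add, h, mul_zpow, mul_zpow]
    simp only [map_mul, pow_one]
    ring
  rw [key, PowerSeries.coeff_C_mul]
  have hc := coeff_invPow (1 / 2 - n) q 0
  simp only [PowerSeries.coeff_zero_eq_constantCoeff, zero_add, pow_zero, Nat.choose_self,
    Nat.cast_one, one_mul, map_mul, map_add, map_one, PowerSeries.constantCoeff_X, zero_mul,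
    add_zero] at hc ⊢
  rw [hc]
  ring

theorem residue_half (I I₁ I₂ : Finset ℤ) (x x₁ x₂ : ℂ) {p₁ p₂ q : ℕ} (hp₁ : 1 ≤ p₁)
    (hp₂ : 1 ≤ p₂) (hq : 1 ≤ q) :
    (locSum I 1 x (-1 / 2) * locSum I₁ p₁ x₁ (-1 / 2) * locSum I₂ p₂ x₂ (-1 / 2)
      * poleAt (-1 / 2) (-1 / 2) ^ q).coeff (-1) = coeff (q - 1)
        (halfExp I 1 x * halfExp I₁ p₁ x₁ * halfExp I₂ p₂ x₂) := by
  apply coeff_neg_one_of_X_pow_mul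
  rw [locSum_half _ le_rfl, locSum_half _ hp₁, locSum_half _ hp₂, poleAt_self, Nat.sub_add_cancel hq,
    mul_left_comm, inv_pow, mul_inv_cancel₀ (pow_ne_zero _ toLaurent_X_ne_zero)]
  simp only [map_mul, mul_one]

/-- The sum of all residues of `Φ ψ₁ ψ₂ / (s + 1/2)^q`, with `Φ = ∑_{|m| ≤ N + M} x^m / (s + m)` and
`ψ = ∑_{1 ≤ k ≤ N} x^k / (s + k)^p`, vanishes. -/
theorem truncated_residue_identity (N M : ℕ) {x x₁ x₂ : ℂ} (hx : x ≠ 0) (hx₁ : x₁ ≠ 0)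
    (hx₂ : x₂ ≠ 0) {p₁ p₂ q : ℕ} (hp₁ : 1 ≤ p₁) (hp₂ : 1 ≤ p₂) (hq : 1 ≤ q) :
    coeff (q - 1) (halfExp (Finset.Icc (-((N + M : ℕ) : ℤ)) (N + M : ℕ)) 1 x
        * halfExp (Finset.Icc 1 (N : ℤ)) p₁ x₁ * halfExp (Finset.Icc 1 (N : ℤ)) p₂ x₂)
      + (∑ j ∈ Finset.range (N + M + 1), ((x * x₁ * x₂)⁻¹) ^ j *
          ((zetaSum (j + N) p₁ x₁ - zetaSum j p₁ x₁) * (zetaSum (j + N) p₂ x₂ - zetaSum j p₂ x₂)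
            / (j + 1 / 2) ^ q)
        + (∑ i ∈ Finset.range N, (x * x₁ * x₂) ^ (i + 1) * coeff (p₁ + p₂)
            ((1 + X * reg (Finset.Icc (-((N + M : ℕ) : ℤ)) (N + M : ℕ)) 1 x (i + 1))
              * (1 + X ^ p₁ * reg (Finset.Icc 1 (N : ℤ)) p₁ x₁ (i + 1))
              * (1 + X ^ p₂ * reg (Finset.Icc 1 (N : ℤ)) p₂ x₂ (i + 1))
              * invPow (-(i + 1 / 2)) q)
          + ∑ i ∈ Finset.range M, (x * x₁ * x₂) ^ (N + i + 1) *
            ((-1) ^ p₁ * (zetaSum (i + N) p₁ x₁⁻¹ - zetaSum i p₁ x₁⁻¹)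
              * ((-1) ^ p₂ * (zetaSum (i + N) p₂ x₂⁻¹ - zetaSum i p₂ x₂⁻¹))
            / (-(N + i + 1 / 2)) ^ q))) = 0 := by
  classical
  set I : Finset ℤ := Finset.Icc (-((N + M : ℕ) : ℤ)) (N + M : ℕ) with hI
  have hnot : (-1 / 2 : ℂ) ∉ I.image (fun k : ℤ => -(k : ℂ)) := by
    intro h
    obtain ⟨k, _, hk⟩ := Finset.mem_image.1 h
    exact intCast_sub_half_ne_zero k (by linear_combination -hk)
  have h := sum_residue_locSum (insert (-1 / 2 : ℂ) (I.image fun k : ℤ => -(k : ℂ))) I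
    (Finset.Icc 1 (N : ℤ)) (Finset.Icc 1 (N : ℤ)) x x₁ x₂ p₁ p₂ q (-1 / 2) hq
    (Finset.mem_insert_self _ _)
    (fun k hk => Finset.mem_insert_of_mem (Finset.mem_image_of_mem _ hk))
    (fun k hk => Finset.mem_insert_of_mem (Finset.mem_image_of_mem _ (by
      simp only [hI, Finset.mem_Icc] at hk ⊢; push_cast; omega)))
    (fun k hk => Finset.mem_insert_of_mem (Finset.mem_image_of_mem _ (by
      simp only [hI, Finset.mem_Icc] at hk ⊢; push_cast; omega)))
  rw [Finset.sum_insert hnot, residue_half I _ _ x x₁ x₂ hp₁ hp₂ hq,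
    Finset.sum_image (fun a _ b _ hab => by exact_mod_cast neg_injective hab)] at h
  rw [← h]
  congr 1
  rw [hI, sum_Icc_symm]
  rw [add_comm (∑ l ∈ Finset.Icc 1 (N + M), _)]
  refine Eq.trans ?_ (add_assoc _ _ _)
  congr 1
  · rw [Finset.sum_range_succ']
    rw [add_comm]
    congr 1
    · have h0 : (0 : ℤ) ∈ I := by simp [hI]; omega
      have h1 : (0 : ℤ) ∉ Finset.Icc 1 (N : ℤ) := by simp
      have := residue_of_notMem h0 h1 h1 hx hx₁ hx₂ hp₁ hp₂ hq
      rw [this]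
      have e1 := coeff_zero_reg_neg 0 N p₁ x₁
      have e2 := coeff_zero_reg_neg 0 N p₂ x₂
      simp only [Nat.cast_zero, neg_zero] at e1 e2
      rw [e1, e2]
      simp
    · rw [sum_Icc_one_eq_range]
      refine Finset.sum_congr rfl fun j hj => ?_
      rw [Finset.mem_range] at hj
      rw [residue_of_notMem (by simp; omega) (by simp; omega) (by simp; omega)
        hx hx₁ hx₂ hp₁ hp₂ hq, coeff_zero_reg_neg, coeff_zero_reg_neg, zpow_neg, zpow_natCast,
        inv_pow]
      congr 3
      push_cast; ring
  · rw [sum_Icc_one_eq_range, Finset.sum_range_add]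
    congr 1
    · refine Finset.sum_congr rfl fun i hi => ?_
      rw [Finset.mem_range] at hi
      rw [residue_of_mem (by simp; omega) (by simp; omega) (by simp; omega)
        hx hx₁ hx₂ hp₁ hp₂ hq, zpow_natCast]
      push_cast
      congr 4
      ring
    · refine Finset.sum_congr rfl fun i hi => ?_
      rw [Finset.mem_range] at hi
      rw [residue_of_notMem (by simp; omega) (by simp) (by simp)
        hx hx₁ hx₂ hp₁ hp₂ hq, zpow_natCast]
      have e : ((N + i + 1 : ℕ) : ℤ) = N + 1 + i := by push_cast; ring
      rw [e, coeff_zero_reg_gt, coeff_zero_reg_gt]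
      congr 3
      push_cast; ring

/-! ### Uniform tail bounds and convergence of the series -/

theorem norm_sum_pow_mul_antitone_le {x : ℂ} (hx : ‖x‖ = 1) (hx1 : x ≠ 1) {g : ℕ → ℝ}
    (hg : Antitone g) (hg0 : ∀ n, 0 ≤ g n) (N : ℕ) :
    ‖∑ i ∈ Finset.range N, x ^ i * (g i : ℂ)‖ ≤ 2 * g 0 / ‖1 - x‖ := by
  -- Abel summation. With the boundary term added, each step of the induction changes the sum by
  -- exactly x^(N+1) (g N - g (N+1)), and these norms telescope because g decreases.
  have key : ‖(1 - x) * ∑ i ∈ Finset.range N, x ^ i * (g i : ℂ) + x ^ N * (g N : ℂ)‖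
      ≤ 2 * g 0 - g N := by
    induction N with
    | zero => simp [abs_of_nonneg (hg0 0)]; linarith
    | succ N ih =>
      have e : (1 - x) * ∑ i ∈ Finset.range (N + 1), x ^ i * (g i : ℂ)
          + x ^ (N + 1) * (g (N + 1) : ℂ)
          = ((1 - x) * ∑ i ∈ Finset.range N, x ^ i * (g i : ℂ) + x ^ N * (g N : ℂ))
            - x ^ (N + 1) * ((g N - g (N + 1) : ℝ) : ℂ) := by
        rw [Finset.sum_range_succ]; push_cast; ring
      have h1 : ‖x ^ (N + 1) * ((g N - g (N + 1) : ℝ) : ℂ)‖ = g N - g (N + 1) := by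
        rw [norm_mul, norm_pow, hx, one_pow, one_mul, Complex.norm_real, Real.norm_of_nonneg]
        linarith [hg (Nat.le_succ N)]
      rw [e]
      refine (norm_sub_le _ _).trans ?_
      rw [h1]
      linarith
  have hpos : 0 < ‖1 - x‖ := norm_pos_iff.2 (sub_ne_zero.2 hx1.symm)
  rw [le_div_iff₀ hpos, mul_comm, ← norm_mul]
  have h1 : ‖x ^ N * (g N : ℂ)‖ = g N := by
    rw [norm_mul, norm_pow, hx, one_pow, one_mul, Complex.norm_real, Real.norm_of_nonneg (hg0 N)]
  have := norm_sub_le ((1 - x) * ∑ i ∈ Finset.range N, x ^ i * (g i : ℂ) + x ^ N * (g N : ℂ))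
    (x ^ N * (g N : ℂ))
  rw [add_sub_cancel_right, h1] at this
  linarith

/-- Telescoping with shifts by 1/2: (a - 1/2)(a + 1/2) < a², so 1/a² ≤ 1/(a - 1/2) - 1/(a + 1/2). -/
theorem sum_range_one_div_sq_le (j N : ℕ) :
    ∑ i ∈ Finset.range N, 1 / ((j + i : ℕ) + 1 : ℝ) ^ 2 ≤ 2 / ((j : ℝ) + 1) := by
  have key : ∑ i ∈ Finset.range N, 1 / ((j + i : ℕ) + 1 : ℝ) ^ 2
      ≤ 1 / ((j : ℝ) + 1 / 2) - 1 / ((j : ℝ) + N + 1 / 2) := by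
    induction N with
    | zero => simp
    | succ N ih =>
      rw [Finset.sum_range_succ]
      have : 1 / ((j + N : ℕ) + 1 : ℝ) ^ 2
          ≤ 1 / ((j : ℝ) + N + 1 / 2) - 1 / ((j : ℝ) + (N + 1 : ℕ) + 1 / 2) := by
        push_cast
        rw [div_sub_div _ _ (by positivity) (by positivity), div_le_div_iff₀ (by positivity)
          (by positivity)]
        nlinarith [sq_nonneg ((j : ℝ) + N)]
      linarith
  refine key.trans ?_
  have h1 : (0 : ℝ) ≤ 1 / ((j : ℝ) + N + 1 / 2) := by positivity
  have h2 : 1 / ((j : ℝ) + 1 / 2) ≤ 2 / (j + 1) := by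
    rw [div_le_div_iff₀ (by positivity) (by positivity)]; linarith
  linarith

/-- The same rate 1/(j + 1) arises in two ways: for x = 1 from quadratic decay, for x ≠ 1 from
oscillation. The product of two such tails is summable, which is what the quadratic sums need. -/
theorem exists_tail_bound {x : ℂ} (hx : ‖x‖ = 1) {f : ℕ → ℝ} (hf : Antitone f)
    (hf0 : ∀ n, 0 ≤ f n) {K : ℝ} (hK : ∀ n : ℕ, f n ≤ K / (n + 1))
    (hK1 : x = 1 → ∀ n : ℕ, f n ≤ K / (n + 1) ^ 2) :
    ∃ D : ℝ, 0 ≤ D ∧ ∀ j N : ℕ,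
      ‖∑ i ∈ Finset.range N, x ^ (j + i) * (f (j + i) : ℂ)‖ ≤ D / (j + 1) := by
  have hK0 : 0 ≤ K := by have := (hf0 0).trans (hK 0); simpa using this
  by_cases hx1 : x = 1
  · refine ⟨2 * K, by positivity, fun j N => ?_⟩
    calc ‖∑ i ∈ Finset.range N, x ^ (j + i) * (f (j + i) : ℂ)‖
        ≤ ∑ i ∈ Finset.range N, K * (1 / ((j + i : ℕ) + 1 : ℝ) ^ 2) := by
          refine norm_sum_le_of_le _ fun i _ => ?_
          rw [hx1, one_pow, one_mul, Complex.norm_real, Real.norm_of_nonneg (hf0 _), mul_one_div]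
          exact hK1 hx1 (j + i)
      _ ≤ K * (2 / (j + 1)) := by
          rw [← Finset.mul_sum]
          exact mul_le_mul_of_nonneg_left (sum_range_one_div_sq_le j N) hK0
      _ = _ := by ring
  · refine ⟨2 * K / ‖1 - x‖, by positivity, fun j N => ?_⟩
    have := norm_sum_pow_mul_antitone_le hx hx1 (g := fun i => f (j + i))
      (fun a b h => hf (by omega)) (fun n => hf0 _) N
    simp only [pow_add, mul_assoc]
    rw [← Finset.mul_sum, norm_mul, norm_pow, hx, one_pow, one_mul]
    refine this.trans ?_
    calc 2 * f (j + 0) / ‖1 - x‖ ≤ 2 * (K / (j + 1)) / ‖1 - x‖ := by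
          gcongr
          exact hK j
      _ = _ := by ring

theorem two_mul_natCast_add_half_ge (n : ℕ) : (n + 1 : ℝ) ≤ 2 * (n + 1 / 2) := by
  have : (0 : ℝ) ≤ n := n.cast_nonneg
  linarith

theorem one_div_pow_le_of_half {p : ℕ} (n : ℕ) :
    1 / ((n : ℝ) + 1 / 2) ^ p ≤ 2 ^ p / (n + 1) ^ p := by
  rw [div_le_div_iff₀ (by positivity) (by positivity), one_mul, ← mul_pow]
  exact pow_le_pow_left₀ (by positivity) (two_mul_natCast_add_half_ge n) p

theorem one_div_pow_le_one_div_pow_nat {p r : ℕ} (h : r ≤ p) (n : ℕ) :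
    1 / ((n : ℝ) + 1) ^ p ≤ 1 / (n + 1) ^ r :=
  one_div_le_one_div_of_le (by positivity) (pow_le_pow_right₀ (by simp) h)

theorem two_le_of_ne {p : ℕ} {x : ℂ} (hp : 1 ≤ p) (h : (p, x) ≠ (1, 1)) (hx : x = 1) : 2 ≤ p := by
  by_contra hc
  exact h (by rw [hx, show p = 1 by omega])

theorem zetaSum_eq_range (n p : ℕ) (x : ℂ) :
    zetaSum n p x = ∑ i ∈ Finset.range n, x ^ (i + 1) / ((i : ℂ) + 1) ^ p := by
  rw [zetaSum, sum_Icc_one_eq_range]; simp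

theorem tSum_eq_range (n p : ℕ) (x : ℂ) :
    tSum n p x = ∑ i ∈ Finset.range n, x ^ (i + 1) / ((i : ℂ) + 1 / 2) ^ p := by
  rw [tSum, sum_Icc_one_eq_range]
  refine Finset.sum_congr rfl fun i _ => ?_
  congr 2
  push_cast; ring

theorem exists_zetaSum_tail_bound {p : ℕ} {x : ℂ} (hx : ‖x‖ = 1) (hp : 1 ≤ p)
    (h : (p, x) ≠ (1, 1)) :
    ∃ D : ℝ, 0 ≤ D ∧ ∀ j N : ℕ, ‖zetaSum (j + N) p x - zetaSum j p x‖ ≤ D / (j + 1) := by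
  obtain ⟨D, hD, hb⟩ := exists_tail_bound hx (f := fun n => 1 / ((n : ℝ) + 1) ^ p) (K := 1)
    (fun a b hab => one_div_le_one_div_of_le (by positivity) (by gcongr)) (fun n => by positivity)
    (fun n => by simpa using one_div_pow_le_one_div_pow_nat hp n)
    (fun h1 n => one_div_pow_le_one_div_pow_nat (two_le_of_ne hp h h1) n)
  refine ⟨D, hD, fun j N => ?_⟩
  have e : zetaSum (j + N) p x - zetaSum j p x
      = x * ∑ i ∈ Finset.range N, x ^ (j + i) * ((1 / (((j + i : ℕ) : ℝ) + 1) ^ p : ℝ) : ℂ) := by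
    rw [zetaSum_eq_range, zetaSum_eq_range, Finset.sum_range_add, add_sub_cancel_left,
      Finset.mul_sum]
    refine Finset.sum_congr rfl fun i _ => ?_
    push_cast; ring
  rw [e, norm_mul, hx, one_mul]
  exact hb j N

theorem exists_tSum_tail_bound {p : ℕ} {x : ℂ} (hx : ‖x‖ = 1) (hp : 1 ≤ p)
    (h : (p, x) ≠ (1, 1)) :
    ∃ D : ℝ, 0 ≤ D ∧ ∀ j N : ℕ, ‖tSum (j + N) p x - tSum j p x‖ ≤ D / (j + 1) := by
  have aux : ∀ r : ℕ, r ≤ p → ∀ n : ℕ, 1 / ((n : ℝ) + 1 / 2) ^ p ≤ 2 ^ p / (n + 1) ^ r := by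
    intro r hr n
    refine (one_div_pow_le_of_half n).trans ?_
    rw [← mul_one_div, ← mul_one_div (2 ^ p : ℝ) (((n : ℝ) + 1) ^ r)]
    exact mul_le_mul_of_nonneg_left (one_div_pow_le_one_div_pow_nat hr n) (by positivity)
  obtain ⟨D, hD, hb⟩ := exists_tail_bound hx (f := fun n => 1 / ((n : ℝ) + 1 / 2) ^ p) (K := 2 ^ p)
    (fun a b hab => one_div_le_one_div_of_le (by positivity) (by gcongr)) (fun n => by positivity)
    (fun n => by simpa using aux 1 hp n)
    (fun h1 n => aux 2 (two_le_of_ne hp h h1) n)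
  refine ⟨D, hD, fun j N => ?_⟩
  have e : tSum (j + N) p x - tSum j p x
      = x * ∑ i ∈ Finset.range N, x ^ (j + i) * ((1 / (((j + i : ℕ) : ℝ) + 1 / 2) ^ p : ℝ) : ℂ) := by
    rw [tSum_eq_range, tSum_eq_range, Finset.sum_range_add, add_sub_cancel_left,
      Finset.mul_sum]
    refine Finset.sum_congr rfl fun i _ => ?_
    push_cast; ring
  rw [e, norm_mul, hx, one_mul]
  exact hb j N

theorem tendsto_limUnder_of_tail_bound {u : ℕ → ℂ} {D : ℝ}
    (h : ∀ j N : ℕ, ‖u (j + N) - u j‖ ≤ D / (j + 1)) :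
    Tendsto u atTop (𝓝 (limUnder atTop u)) := by
  apply tendsto_nhds_limUnder
  apply cauchySeq_tendsto_of_complete
  refine cauchySeq_of_le_tendsto_0' (fun n : ℕ => D * (1 / ((n : ℝ) + 1))) (fun n m hnm => ?_) ?_
  · obtain ⟨k, rfl⟩ := Nat.exists_eq_add_of_le hnm
    rw [dist_comm, dist_eq_norm, mul_one_div]
    exact h n k
  · simpa using (tendsto_one_div_add_atTop_nhds_zero_nat (𝕜 := ℝ)).const_mul D

theorem tendsto_zetaSum {p : ℕ} {x : ℂ} (hx : ‖x‖ = 1) (hp : 1 ≤ p) (h : (p, x) ≠ (1, 1)) :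
    Tendsto (fun n => zetaSum n p x) atTop (𝓝 (Li p x)) := by
  obtain ⟨D, -, hD⟩ := exists_zetaSum_tail_bound hx hp h
  exact tendsto_limUnder_of_tail_bound hD

theorem tendsto_tSum {p : ℕ} {x : ℂ} (hx : ‖x‖ = 1) (hp : 1 ≤ p) (h : (p, x) ≠ (1, 1)) :
    Tendsto (fun n => tSum n p x) atTop (𝓝 (ti p x)) := by
  obtain ⟨D, -, hD⟩ := exists_tSum_tail_bound hx hp h
  exact tendsto_limUnder_of_tail_bound hD

theorem exists_Li_sub_zetaSum_bound {p : ℕ} {x : ℂ} (hx : ‖x‖ = 1) (hp : 1 ≤ p)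
    (h : (p, x) ≠ (1, 1)) :
    ∃ D : ℝ, 0 ≤ D ∧ ∀ j : ℕ, ‖zetaSum j p x - Li p x‖ ≤ D / (j + 1) := by
  obtain ⟨D, hD0, hD⟩ := exists_zetaSum_tail_bound hx hp h
  refine ⟨D, hD0, fun j => ?_⟩
  have h1 : Tendsto (fun N => zetaSum (j + N) p x - zetaSum j p x) atTop
      (𝓝 (Li p x - zetaSum j p x)) :=
    ((tendsto_zetaSum hx hp h).comp (tendsto_add_atTop_nat j)).congr (fun N => by
      simp [add_comm]) |>.sub_const _
  rw [norm_sub_rev]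
  exact le_of_tendsto h1.norm (Eventually.of_forall (hD j))

theorem summable_one_div_natCast_succ_sq : Summable fun n : ℕ => 1 / ((n : ℝ) + 1) ^ 2 := by
  have := (summable_nat_add_iff 1).2 (Real.summable_one_div_nat_pow.2 one_lt_two)
  simpa using this

theorem norm_natCast_add_half (n : ℕ) : ‖(n : ℂ) + 1 / 2‖ = n + 1 / 2 := by
  have : (n : ℂ) + 1 / 2 = ((n + 1 / 2 : ℝ) : ℂ) := by push_cast; ring
  rw [this, Complex.norm_real, Real.norm_of_nonneg (by positivity)]

theorem norm_inv_half_pow_le {q : ℕ} (hq : 1 ≤ q) (n : ℕ) :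
    ‖(((n : ℂ) + 1 / 2) ^ q)⁻¹‖ ≤ 2 ^ q / (n + 1) := by
  rw [norm_inv, norm_pow, norm_natCast_add_half, ← one_div]
  refine (one_div_pow_le_of_half n).trans ?_
  gcongr
  exact le_self_pow₀ (by simp) (by omega)

theorem exists_tendsto_sum_of_sub_bound {c : ℕ → ℂ} {L : ℂ} {D : ℝ}
    (hc : ∀ n : ℕ, ‖c n - L‖ ≤ D / (n + 1)) {q : ℕ} {z : ℂ} (hz : ‖z‖ = 1) (hq : 1 ≤ q)
    (h : (q, z) ≠ (1, 1)) :
    ∃ l, Tendsto (fun N => ∑ n ∈ Finset.range N, c n / ((n : ℂ) + 1 / 2) ^ q * z ^ n) atTop (𝓝 l) := by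
  have hz0 : z ≠ 0 := by rintro rfl; simp at hz
  have hs : Summable fun n : ℕ => (c n - L) / ((n : ℂ) + 1 / 2) ^ q * z ^ n := by
    refine Summable.of_norm_bounded (summable_one_div_natCast_succ_sq.mul_left (D * 2 ^ q))
      fun n => ?_
    rw [norm_mul, norm_pow, hz, one_pow, mul_one, div_eq_mul_inv, norm_mul]
    calc _ ≤ D / (n + 1) * (2 ^ q / (n + 1)) :=
          mul_le_mul (hc n) (norm_inv_half_pow_le hq n) (norm_nonneg _)
            ((norm_nonneg _).trans (hc n))
      _ = _ := by field_simp
  -- Splitting c n = L + (c n - L) isolates the possibly conditional convergence in a multiple of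
  -- `ti`; the remainder converges absolutely. The z⁻¹ corrects z^(n+1) in `tSum` to z^n.
  refine ⟨L * (z⁻¹ * ti q z) + ∑' n : ℕ, (c n - L) / ((n : ℂ) + 1 / 2) ^ q * z ^ n, ?_⟩
  refine ((((tendsto_tSum hz hq h).const_mul z⁻¹).const_mul L).add
    hs.hasSum.tendsto_sum_nat).congr fun N => ?_
  rw [tSum_eq_range, Finset.mul_sum, Finset.mul_sum, ← Finset.sum_add_distrib]
  refine Finset.sum_congr rfl fun n _ => ?_
  rw [pow_succ]
  field_simp
  ring

theorem RPartial_one (a : ℕ) (x : ℂ) (b : ℕ) (z : ℂ) (N : ℕ) : RPartial ![a] ![x] b z N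
    = ∑ n ∈ Finset.range N, zetaSum n a x / ((n : ℂ) + 1 / 2) ^ b * z ^ n := by
  simp [RPartial]

theorem RPartial_two (a₁ a₂ : ℕ) (x₁ x₂ : ℂ) (b : ℕ) (z : ℂ) (N : ℕ) :
    RPartial ![a₁, a₂] ![x₁, x₂] b z N = ∑ n ∈ Finset.range N,
      (zetaSum n a₁ x₁ * zetaSum n a₂ x₂) / ((n : ℂ) + 1 / 2) ^ b * z ^ n := by
  simp [RPartial, Fin.prod_univ_two]

theorem RConverges_one {a : ℕ} {x : ℂ} {b : ℕ} {z : ℂ} (hx : ‖x‖ = 1) (ha : 1 ≤ a)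
    (hax : (a, x) ≠ (1, 1)) (hz : ‖z‖ = 1) (hb : 1 ≤ b) (hbz : (b, z) ≠ (1, 1)) :
    RConverges ![a] ![x] b z := by
  obtain ⟨D, hD0, hD⟩ := exists_Li_sub_zetaSum_bound hx ha hax
  obtain ⟨l, hl⟩ := exists_tendsto_sum_of_sub_bound hD hz hb hbz
  exact ⟨l, hl.congr fun N => (RPartial_one ..).symm⟩

theorem RConverges_two {a₁ a₂ : ℕ} {x₁ x₂ : ℂ} {b : ℕ} {z : ℂ} (hx₁ : ‖x₁‖ = 1) (ha₁ : 1 ≤ a₁)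
    (hax₁ : (a₁, x₁) ≠ (1, 1)) (hx₂ : ‖x₂‖ = 1) (ha₂ : 1 ≤ a₂)
    (hax₂ : (a₂, x₂) ≠ (1, 1)) (hz : ‖z‖ = 1) (hb : 1 ≤ b) (hbz : (b, z) ≠ (1, 1)) :
    RConverges ![a₁, a₂] ![x₁, x₂] b z := by
  obtain ⟨D₁, hD₁0, hD₁⟩ := exists_Li_sub_zetaSum_bound hx₁ ha₁ hax₁
  obtain ⟨D₂, hD₂0, hD₂⟩ := exists_Li_sub_zetaSum_bound hx₂ ha₂ hax₂
  have hc : ∀ n : ℕ, ‖zetaSum n a₁ x₁ * zetaSum n a₂ x₂ - Li a₁ x₁ * Li a₂ x₂‖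
      ≤ (D₁ * D₂ + D₁ * ‖Li a₂ x₂‖ + ‖Li a₁ x₁‖ * D₂) / (n + 1) := by
    intro n
    have e : zetaSum n a₁ x₁ * zetaSum n a₂ x₂ - Li a₁ x₁ * Li a₂ x₂
        = (zetaSum n a₁ x₁ - Li a₁ x₁) * (zetaSum n a₂ x₂ - Li a₂ x₂)
          + (zetaSum n a₁ x₁ - Li a₁ x₁) * Li a₂ x₂
          + Li a₁ x₁ * (zetaSum n a₂ x₂ - Li a₂ x₂) := by ring
    have h2 : D₂ / ((n : ℝ) + 1) ≤ D₂ := div_le_self hD₂0 (by simp)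
    rw [e]
    refine (norm_add₃_le).trans ?_
    rw [norm_mul, norm_mul, norm_mul]
    calc _ ≤ D₁ / (n + 1) * D₂ + D₁ / (n + 1) * ‖Li a₂ x₂‖ + ‖Li a₁ x₁‖ * (D₂ / (n + 1)) := by
          gcongr
          · exact hD₁ n
          · exact (hD₂ n).trans h2
          · exact hD₁ n
          · exact hD₂ n
      _ = _ := by ring
  obtain ⟨l, hl⟩ := exists_tendsto_sum_of_sub_bound hc hz hb hbz
  exact ⟨l, hl.congr fun N => (RPartial_two ..).symm⟩

theorem RConverges.tendsto {r : ℕ} {p : Fin r → ℕ} {x : Fin r → ℂ} {q : ℕ} {z : ℂ}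
    (h : RConverges p x q z) : Tendsto (RPartial p x q z) atTop (𝓝 (R p x q z)) :=
  tendsto_nhds_limUnder h

/-! ### The limit M → ∞: completing the kernel -/

open scoped PowerSeries.WithPiTopology

/-- The regular part of `∑_{m ∈ ℤ} x^m / (s + m)` at `s = 0`. -/
def kernelExp (x : ℂ) : PowerSeries ℂ :=
  PowerSeries.mk fun k => (-1) ^ k * Li (k + 1) x - Li (k + 1) x⁻¹

/-- The expansion of `∑_{m ∈ ℤ} x^m / (s + m)` at `s = -1/2`. -/
def kernelHalfExp (x : ℂ) : PowerSeries ℂ :=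
  PowerSeries.mk fun k => (-1) ^ k * ti (k + 1) x - x * ti (k + 1) x⁻¹

theorem tendsto_const_mul_one_div_succ (c : ℝ) :
    Tendsto (fun n : ℕ => c * (1 / ((n : ℝ) + 1))) atTop (𝓝 0) := by
  simpa using (tendsto_one_div_add_atTop_nhds_zero_nat (𝕜 := ℝ)).const_mul c

theorem pair_inv_ne {p : ℕ} {x : ℂ} (h : (p, x) ≠ (1, 1)) : (p, x⁻¹) ≠ (1, 1) := by
  intro e
  apply h
  simp only [Prod.mk.injEq, inv_eq_one] at e ⊢
  exact e

theorem norm_zetaSum_one_one_add_sub_le (h d : ℕ) :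
    ‖zetaSum (h + d) 1 1 - zetaSum h 1 1‖ ≤ d * (1 / ((h : ℝ) + 1)) := by
  rw [zetaSum_eq_range, zetaSum_eq_range, Finset.sum_range_add, add_sub_cancel_left]
  calc _ ≤ ∑ i ∈ Finset.range d, 1 / ((h : ℝ) + 1) := by
        refine norm_sum_le_of_le _ fun i _ => ?_
        have e : (((h + i : ℕ) : ℂ) + 1) ^ 1 = (((h + i : ℕ) + 1 : ℝ) : ℂ) := by push_cast; ring
        rw [e, one_pow, norm_div, norm_one, Complex.norm_real, Real.norm_of_nonneg (by positivity)]
        apply one_div_le_one_div_of_le (by positivity)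
        push_cast
        linarith [(Nat.cast_nonneg i : (0 : ℝ) ≤ i)]
    _ = _ := by simp

/-- The lengths of the two sums differ by a fixed d. When k = 0 and x = 1 both diverge, but their
difference consists of d terms tending to 0; the stated limit is then `Li 1 1 - Li 1 1`, which is 0
whatever value `limUnder` assigns to `Li 1 1`. This is the convention A_0 = 0. -/
theorem tendsto_kernel_coeff {x : ℂ} (hx : ‖x‖ = 1) (k h d : ℕ) :
    Tendsto (fun M => (-1) ^ k * zetaSum (h + M) (k + 1) x - zetaSum (h + M + d) (k + 1) x⁻¹) atTop
      (𝓝 ((-1) ^ k * Li (k + 1) x - Li (k + 1) x⁻¹)) := by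
  by_cases hc : (k + 1, x) = (1, 1)
  · obtain ⟨hk, rfl⟩ : k = 0 ∧ x = 1 := by simpa using hc
    subst hk
    simp only [pow_zero, one_mul, inv_one, sub_self, zero_add]
    rw [tendsto_zero_iff_norm_tendsto_zero]
    refine squeeze_zero (fun _ => norm_nonneg _) (fun M => ?_)
      (g := fun M : ℕ => (d : ℝ) * (1 / (((M + h : ℕ) : ℝ) + 1))) ?_
    · rw [norm_sub_rev, add_comm M h]
      exact norm_zetaSum_one_one_add_sub_le (h + M) d
    · exact (tendsto_const_mul_one_div_succ d).comp (tendsto_add_atTop_nat h)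
  · have h1 := tendsto_zetaSum hx (by omega) hc
    have h2 := tendsto_zetaSum (x := x⁻¹) (by simp [hx]) (by omega) (pair_inv_ne hc)
    refine Tendsto.sub (Tendsto.const_mul _ ?_) ?_
    · exact (h1.comp (tendsto_add_atTop_nat h)).congr fun M => by simp [add_comm]
    · exact (h2.comp (tendsto_add_atTop_nat (h + d))).congr fun M => by
        simp only [Function.comp]; congr 1; omega

theorem tendsto_kernelHalf_coeff {x : ℂ} (hx : ‖x‖ = 1) (k : ℕ) :
    Tendsto (fun M => (-1) ^ k * tSum M (k + 1) x - x * tSum (M + 1) (k + 1) x⁻¹) atTop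
      (𝓝 ((-1) ^ k * ti (k + 1) x - x * ti (k + 1) x⁻¹)) := by
  by_cases hc : (k + 1, x) = (1, 1)
  · obtain ⟨hk, rfl⟩ : k = 0 ∧ x = 1 := by simpa using hc
    subst hk
    simp only [pow_zero, one_mul, inv_one, sub_self, zero_add]
    rw [tendsto_zero_iff_norm_tendsto_zero]
    refine squeeze_zero (fun _ => norm_nonneg _) (fun M => ?_)
      (g := fun M : ℕ => 2 ^ 1 * (1 / ((M : ℝ) + 1))) ?_
    · rw [tSum_eq_range, tSum_eq_range, Finset.sum_range_succ, sub_add_cancel_left, norm_neg,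
        one_pow, one_div, mul_one_div]
      simpa using norm_inv_half_pow_le le_rfl M
    · exact tendsto_const_mul_one_div_succ _
  · have h1 := tendsto_tSum hx (by omega) hc
    have h2 := tendsto_tSum (x := x⁻¹) (by simp [hx]) (by omega) (pair_inv_ne hc)
    exact (h1.const_mul _).sub ((h2.comp (tendsto_add_atTop_nat 1)).const_mul _)

theorem tendsto_reg_kernel {x : ℂ} (hx : ‖x‖ = 1) {N i : ℕ} (hi : i < N) :
    Tendsto (fun M : ℕ => reg (Finset.Icc (-((N + M : ℕ) : ℤ)) (N + M : ℕ)) 1 x (i + 1)) atTop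
      (𝓝 (kernelExp x)) := by
  rw [PowerSeries.WithPiTopology.tendsto_iff_coeff_tendsto]
  intro k
  rw [kernelExp, PowerSeries.coeff_mk]
  -- Seen from i + 1, the interval [-(N + M), N + M] extends N + M - (i + 1) to the right and 2(i +
  -- 1) further to the left.
  refine (tendsto_kernel_coeff hx k (N - (i + 1)) (2 * (i + 1))).congr fun M => ?_
  have e1 : (-((N + M : ℕ) : ℤ)) = ((i : ℤ) + 1) - (N - (i + 1) + M + 2 * (i + 1) : ℕ) := by omega
  have e2 : ((N + M : ℕ) : ℤ) = ((i : ℤ) + 1) + (N - (i + 1) + M : ℕ) := by omega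
  rw [e1, e2, coeff_reg_Icc]
  have e3 : (-1 : ℂ) ^ k * (-1) ^ (k + 1) = -1 := by
    rw [← pow_add, show k + (k + 1) = 2 * k + 1 by ring, pow_succ, pow_mul]; norm_num
  simp only [Nat.sub_self, Nat.choose_zero_right, Nat.cast_one, mul_one]
  linear_combination (-zetaSum (N - (i + 1) + M + 2 * (i + 1)) (k + 1) x⁻¹) * e3

theorem tendsto_halfExp_kernel {x : ℂ} (hx : ‖x‖ = 1) (N : ℕ) :
    Tendsto (fun M : ℕ => halfExp (Finset.Icc (-((N + M : ℕ) : ℤ)) (N + M : ℕ)) 1 x) atTop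
      (𝓝 (kernelHalfExp x)) := by
  rw [PowerSeries.WithPiTopology.tendsto_iff_coeff_tendsto]
  intro k
  rw [kernelHalfExp, PowerSeries.coeff_mk]
  have hx0 : x ≠ 0 := by rintro rfl; simp at hx
  refine ((tendsto_kernelHalf_coeff hx k).comp (tendsto_add_atTop_nat N)).congr fun M => ?_
  rw [add_comm N M]
  exact (coeff_halfExp_symm (M + N) k hx0).symm

/-- The product of two differences of partial sums, divided by a power of `n + 1/2`. -/
theorem exists_norm_tail_mul_tail_bound {p₁ p₂ : ℕ} {x₁ x₂ : ℂ} (hx₁ : ‖x₁‖ = 1) (hx₂ : ‖x₂‖ = 1)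
    (hp₁ : 1 ≤ p₁) (hp₂ : 1 ≤ p₂) (h₁ : (p₁, x₁) ≠ (1, 1)) (h₂ : (p₂, x₂) ≠ (1, 1)) :
    ∃ D : ℝ, ∀ N j : ℕ, ‖(zetaSum (j + N) p₁ x₁ - zetaSum j p₁ x₁)
      * (zetaSum (j + N) p₂ x₂ - zetaSum j p₂ x₂)‖ ≤ D * (1 / ((j : ℝ) + 1) ^ 2) := by
  obtain ⟨D₁, hD₁0, hD₁⟩ := exists_zetaSum_tail_bound hx₁ hp₁ h₁
  obtain ⟨D₂, hD₂0, hD₂⟩ := exists_zetaSum_tail_bound hx₂ hp₂ h₂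
  refine ⟨D₁ * D₂, fun N j => ?_⟩
  rw [norm_mul]
  calc _ ≤ D₁ / (j + 1) * (D₂ / (j + 1)) := by
        gcongr
        · exact hD₁ j N
        · exact hD₂ j N
    _ = _ := by field_simp

theorem norm_inv_half_pow_le_two_pow (q n : ℕ) : ‖(((n : ℂ) + 1 / 2) ^ q)⁻¹‖ ≤ 2 ^ q := by
  rw [norm_inv, norm_pow, norm_natCast_add_half, ← inv_pow]
  refine pow_le_pow_left₀ (by positivity) ?_ q
  rw [inv_le_comm₀ (by positivity) (by norm_num)]
  linarith [(Nat.cast_nonneg n : (0 : ℝ) ≤ n)]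

/-- The residue at `s = j ≥ 0`, with `ψ₁, ψ₂` truncated at `N`. -/
def posTerm (w x₁ x₂ : ℂ) (p₁ p₂ q N j : ℕ) : ℂ :=
  w⁻¹ ^ j * ((zetaSum (j + N) p₁ x₁ - zetaSum j p₁ x₁) * (zetaSum (j + N) p₂ x₂ - zetaSum j p₂ x₂)
    / (j + 1 / 2) ^ q)

/-- The residue at `s = -(N + i + 1)`, with `ψ₁, ψ₂` truncated at `N`. -/
def negTerm (w x₁ x₂ : ℂ) (p₁ p₂ q N i : ℕ) : ℂ :=
  w ^ (N + i + 1) * ((-1) ^ p₁ * (zetaSum (i + N) p₁ x₁⁻¹ - zetaSum i p₁ x₁⁻¹)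
      * ((-1) ^ p₂ * (zetaSum (i + N) p₂ x₂⁻¹ - zetaSum i p₂ x₂⁻¹)) / (-(N + i + 1 / 2)) ^ q)

section

variable {w x₁ x₂ : ℂ} {p₁ p₂ q : ℕ}

theorem exists_posTerm_bound (hw : ‖w‖ = 1) (hx₁ : ‖x₁‖ = 1) (hx₂ : ‖x₂‖ = 1)
    (hp₁ : 1 ≤ p₁) (hp₂ : 1 ≤ p₂) (h₁ : (p₁, x₁) ≠ (1, 1)) (h₂ : (p₂, x₂) ≠ (1, 1)) (q : ℕ) :
    ∃ D : ℝ, ∀ N j : ℕ, ‖posTerm w x₁ x₂ p₁ p₂ q N j‖ ≤ D * (1 / ((j : ℝ) + 1) ^ 2) := by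
  obtain ⟨D, hD⟩ := exists_norm_tail_mul_tail_bound hx₁ hx₂ hp₁ hp₂ h₁ h₂
  refine ⟨D * 2 ^ q, fun N j => ?_⟩
  rw [posTerm, norm_mul, norm_pow, norm_inv, hw, inv_one, one_pow, one_mul, div_eq_mul_inv, norm_mul,
    mul_right_comm]
  exact mul_le_mul (hD N j) (norm_inv_half_pow_le_two_pow q j) (norm_nonneg _)
    ((norm_nonneg _).trans (hD N j))

theorem exists_negTerm_bound (hw : ‖w‖ = 1) (hx₁ : ‖x₁‖ = 1) (hx₂ : ‖x₂‖ = 1)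
    (hp₁ : 1 ≤ p₁) (hp₂ : 1 ≤ p₂) (hq : 1 ≤ q) (h₁ : (p₁, x₁) ≠ (1, 1)) (h₂ : (p₂, x₂) ≠ (1, 1)) :
    ∃ D : ℝ, ∀ N i : ℕ, ‖negTerm w x₁ x₂ p₁ p₂ q N i‖
      ≤ D * (1 / ((i : ℝ) + 1) ^ 2) * (2 ^ q / (N + i + 1)) := by
  obtain ⟨D, hD⟩ := exists_norm_tail_mul_tail_bound (x₁ := x₁⁻¹) (x₂ := x₂⁻¹) (by simp [hx₁])
    (by simp [hx₂]) hp₁ hp₂ (pair_inv_ne h₁) (pair_inv_ne h₂)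
  refine ⟨D, fun N i => ?_⟩
  have e : ‖negTerm w x₁ x₂ p₁ p₂ q N i‖ = ‖(zetaSum (i + N) p₁ x₁⁻¹ - zetaSum i p₁ x₁⁻¹)
      * (zetaSum (i + N) p₂ x₂⁻¹ - zetaSum i p₂ x₂⁻¹)‖ * ‖((((N + i : ℕ) : ℂ) + 1 / 2) ^ q)⁻¹‖ := by
    rw [negTerm]
    simp only [norm_mul, norm_pow, norm_neg, norm_one, hw, one_pow, one_mul, norm_inv,
      Nat.cast_add, div_eq_mul_inv]
  rw [e]
  refine mul_le_mul (hD N i) ?_ (norm_nonneg _) ((norm_nonneg _).trans (hD N i))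
  have := norm_inv_half_pow_le hq (N + i)
  push_cast at this ⊢
  exact this

theorem exists_negTerm_bound' (hw : ‖w‖ = 1) (hx₁ : ‖x₁‖ = 1) (hx₂ : ‖x₂‖ = 1)
    (hp₁ : 1 ≤ p₁) (hp₂ : 1 ≤ p₂) (hq : 1 ≤ q) (h₁ : (p₁, x₁) ≠ (1, 1)) (h₂ : (p₂, x₂) ≠ (1, 1)) :
    ∃ D : ℝ, ∀ N i : ℕ, ‖negTerm w x₁ x₂ p₁ p₂ q N i‖
      ≤ D * (1 / ((i : ℝ) + 1) ^ 2) * (1 / (N + 1)) := by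
  obtain ⟨D, hD⟩ := exists_negTerm_bound hw hx₁ hx₂ hp₁ hp₂ hq h₁ h₂
  refine ⟨|D| * 2 ^ q, fun N i => (hD N i).trans ?_⟩
  calc _ ≤ |D| * (1 / ((i : ℝ) + 1) ^ 2) * (2 ^ q / (N + 1)) := by
        gcongr
        · exact le_abs_self D
        · linarith [(Nat.cast_nonneg i : (0 : ℝ) ≤ i)]
    _ = _ := by ring

theorem summable_posTerm (hw : ‖w‖ = 1) (hx₁ : ‖x₁‖ = 1) (hx₂ : ‖x₂‖ = 1)
    (hp₁ : 1 ≤ p₁) (hp₂ : 1 ≤ p₂) (h₁ : (p₁, x₁) ≠ (1, 1)) (h₂ : (p₂, x₂) ≠ (1, 1)) (q N : ℕ) :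
    Summable (posTerm w x₁ x₂ p₁ p₂ q N) := by
  obtain ⟨D, hD⟩ := exists_posTerm_bound hw hx₁ hx₂ hp₁ hp₂ h₁ h₂ q
  exact Summable.of_norm_bounded (summable_one_div_natCast_succ_sq.mul_left D) (hD N)

theorem summable_negTerm (hw : ‖w‖ = 1) (hx₁ : ‖x₁‖ = 1) (hx₂ : ‖x₂‖ = 1)
    (hp₁ : 1 ≤ p₁) (hp₂ : 1 ≤ p₂) (hq : 1 ≤ q) (h₁ : (p₁, x₁) ≠ (1, 1)) (h₂ : (p₂, x₂) ≠ (1, 1))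
    (N : ℕ) : Summable (negTerm w x₁ x₂ p₁ p₂ q N) := by
  obtain ⟨D, hD⟩ := exists_negTerm_bound' hw hx₁ hx₂ hp₁ hp₂ hq h₁ h₂
  exact Summable.of_norm_bounded
    ((summable_one_div_natCast_succ_sq.mul_left D).mul_right (1 / ((N : ℝ) + 1))) (hD N)

/-- The two tails make the sum over i converge uniformly in N, and the factor (N + i + 1/2)^(-q)
with q ≥ 1 supplies the decay in N. -/
theorem tendsto_tsum_negTerm (hw : ‖w‖ = 1) (hx₁ : ‖x₁‖ = 1) (hx₂ : ‖x₂‖ = 1)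
    (hp₁ : 1 ≤ p₁) (hp₂ : 1 ≤ p₂) (hq : 1 ≤ q) (h₁ : (p₁, x₁) ≠ (1, 1)) (h₂ : (p₂, x₂) ≠ (1, 1)) :
    Tendsto (fun N => ∑' i, negTerm w x₁ x₂ p₁ p₂ q N i) atTop (𝓝 0) := by
  obtain ⟨D, hD⟩ := exists_negTerm_bound' hw hx₁ hx₂ hp₁ hp₂ hq h₁ h₂
  have hs := summable_one_div_natCast_succ_sq.mul_left D
  refine squeeze_zero_norm (a := fun N : ℕ => (∑' i : ℕ, D * (1 / ((i : ℝ) + 1) ^ 2)) *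
    (1 / ((N : ℝ) + 1))) (fun N => ?_) ?_
  · rw [← tsum_mul_right]
    exact tsum_of_norm_bounded (hs.mul_right _).hasSum (hD N)
  · exact tendsto_const_mul_one_div_succ _

theorem tendsto_tsum_posTerm (hw : ‖w‖ = 1) (hx₁ : ‖x₁‖ = 1) (hx₂ : ‖x₂‖ = 1)
    (hp₁ : 1 ≤ p₁) (hp₂ : 1 ≤ p₂) (h₁ : (p₁, x₁) ≠ (1, 1)) (h₂ : (p₂, x₂) ≠ (1, 1)) :
    Summable (fun j : ℕ => w⁻¹ ^ j * ((Li p₁ x₁ - zetaSum j p₁ x₁) * (Li p₂ x₂ - zetaSum j p₂ x₂)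
        / (j + 1 / 2) ^ q)) ∧
    Tendsto (fun N => ∑' j, posTerm w x₁ x₂ p₁ p₂ q N j) atTop
      (𝓝 (∑' j : ℕ, w⁻¹ ^ j * ((Li p₁ x₁ - zetaSum j p₁ x₁) * (Li p₂ x₂ - zetaSum j p₂ x₂)
        / (j + 1 / 2) ^ q))) := by
  obtain ⟨D, hD⟩ := exists_posTerm_bound hw hx₁ hx₂ hp₁ hp₂ h₁ h₂ q
  have hs := summable_one_div_natCast_succ_sq.mul_left D
  have ht : ∀ j, Tendsto (fun N => posTerm w x₁ x₂ p₁ p₂ q N j) atTop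
      (𝓝 (w⁻¹ ^ j * ((Li p₁ x₁ - zetaSum j p₁ x₁) * (Li p₂ x₂ - zetaSum j p₂ x₂)
        / (j + 1 / 2) ^ q))) := by
    intro j
    have aux : ∀ {p : ℕ} {x : ℂ}, ‖x‖ = 1 → 1 ≤ p → (p, x) ≠ (1, 1) →
        Tendsto (fun N => zetaSum (j + N) p x) atTop (𝓝 (Li p x)) := fun hx hp h =>
      ((tendsto_zetaSum hx hp h).comp (tendsto_add_atTop_nat j)).congr fun N => by simp [add_comm]
    exact ((((aux hx₁ hp₁ h₁).sub_const _).mul ((aux hx₂ hp₂ h₂).sub_const _)).div_const _).const_mul _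
  refine ⟨Summable.of_norm_bounded hs fun j =>
    le_of_tendsto (ht j).norm (Eventually.of_forall fun N => hD N j), ?_⟩
  exact tendsto_tsum_of_dominated_convergence hs ht (Eventually.of_forall hD)

end

theorem residue_identity (N : ℕ) {x x₁ x₂ : ℂ} (hx : ‖x‖ = 1) (hx₁ : ‖x₁‖ = 1) (hx₂ : ‖x₂‖ = 1)
    {p₁ p₂ q : ℕ} (hp₁ : 1 ≤ p₁) (hp₂ : 1 ≤ p₂) (hq : 1 ≤ q) (h₁ : (p₁, x₁) ≠ (1, 1))
    (h₂ : (p₂, x₂) ≠ (1, 1)) :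
    coeff (q - 1) (kernelHalfExp x
        * halfExp (Finset.Icc 1 (N : ℤ)) p₁ x₁ * halfExp (Finset.Icc 1 (N : ℤ)) p₂ x₂)
      + (∑' j, posTerm (x * x₁ * x₂) x₁ x₂ p₁ p₂ q N j
        + (∑ i ∈ Finset.range N, (x * x₁ * x₂) ^ (i + 1) * coeff (p₁ + p₂)
            ((1 + X * kernelExp x)
              * (1 + X ^ p₁ * reg (Finset.Icc 1 (N : ℤ)) p₁ x₁ (i + 1))
              * (1 + X ^ p₂ * reg (Finset.Icc 1 (N : ℤ)) p₂ x₂ (i + 1))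
              * invPow (-(i + 1 / 2)) q)
          + ∑' i, negTerm (x * x₁ * x₂) x₁ x₂ p₁ p₂ q N i)) = 0 := by
  have hx0 : x ≠ 0 := by rintro rfl; simp at hx
  have hx₁0 : x₁ ≠ 0 := by rintro rfl; simp at hx₁
  have hx₂0 : x₂ ≠ 0 := by rintro rfl; simp at hx₂
  have hw : ‖x * x₁ * x₂‖ = 1 := by simp [hx, hx₁, hx₂]
  have hcoeff : ∀ d : ℕ, Continuous (coeff d : PowerSeries ℂ → ℂ) := fun d =>
    PowerSeries.WithPiTopology.continuous_coeff (R := ℂ) d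
  -- The truncated identity says that a sequence in M is constantly 0; its limit is computed term by
  -- term.
  refine tendsto_nhds_unique (f := fun _ : ℕ => (0 : ℂ)) (l := atTop) ?_ tendsto_const_nhds
  refine Tendsto.congr (fun M => truncated_residue_identity N M hx0 hx₁0 hx₂0 hp₁ hp₂ hq) ?_
  refine Tendsto.add ?_ (Tendsto.add ?_ (Tendsto.add ?_ ?_))
  · exact ((hcoeff _).tendsto _).comp
      (((tendsto_halfExp_kernel hx N).mul_const _).mul_const _)
  · refine ((summable_posTerm hw hx₁ hx₂ hp₁ hp₂ h₁ h₂ q N).hasSum.tendsto_sum_nat.comp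
      (tendsto_add_atTop_nat (N + 1))).congr fun M => ?_
    simp only [Function.comp]
    rw [show M + (N + 1) = N + M + 1 by ring]
    rfl
  · refine tendsto_finsetSum _ fun i hi => Tendsto.const_mul _ ?_
    exact ((hcoeff _).tendsto _).comp ((((((tendsto_reg_kernel hx
      (Finset.mem_range.1 hi)).const_mul X).const_add 1).mul_const _).mul_const _).mul_const _)
  · exact (summable_negTerm hw hx₁ hx₂ hp₁ hp₂ hq h₁ h₂ N).hasSum.tendsto_sum_nat

/-! ### The limit N → ∞: completing the ψ's -/

open Asymptotics

/-- Every coefficient of the family `f` of power series is `O(r)` along `l`. -/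
def CoeffIsBigO {ι : Type*} (l : Filter ι) (f : ι → PowerSeries ℂ) (r : ι → ℝ) : Prop :=
  ∀ k, (fun t => coeff k (f t)) =O[l] r

section

variable {ι : Type*} {l : Filter ι} {f g : ι → PowerSeries ℂ} {r s : ι → ℝ}

theorem CoeffIsBigO.mul (hf : CoeffIsBigO l f r) (hg : CoeffIsBigO l g s) :
    CoeffIsBigO l (fun t => f t * g t) (fun t => r t * s t) := by
  intro k
  simp only [PowerSeries.coeff_mul]
  exact IsBigO.fun_sum fun i _ => (hf i.1).mul (hg i.2)

theorem CoeffIsBigO.add (hf : CoeffIsBigO l f r) (hg : CoeffIsBigO l g r) :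
    CoeffIsBigO l (fun t => f t + g t) r := by
  intro k
  simp only [map_add]
  exact (hf k).add (hg k)

theorem CoeffIsBigO.const (l : Filter ι) (c : PowerSeries ℂ) :
    CoeffIsBigO l (fun _ => c) (fun _ => 1) := fun _ => isBigO_const_const _ one_ne_zero l

theorem CoeffIsBigO.const_mul (c : PowerSeries ℂ) (hf : CoeffIsBigO l f r) :
    CoeffIsBigO l (fun t => c * f t) r := by
  simpa using (CoeffIsBigO.const l c).mul hf

theorem CoeffIsBigO.mul_of_one (hf : CoeffIsBigO l f r) (hg : CoeffIsBigO l g (fun _ => 1)) :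
    CoeffIsBigO l (fun t => f t * g t) r := by
  simpa using hf.mul hg

end

/-- The regular part at `s = -(i + 1)` of `x⁻⁽ⁱ⁺¹⁾ ∑_{k ≥ 1} x^k / (s + k)^p`. -/
def psiExp (p : ℕ) (x : ℂ) (i : ℕ) : PowerSeries ℂ :=
  PowerSeries.mk fun k => (-1) ^ k * ((k + p - 1).choose (p - 1) : ℂ)
    * (Li (k + p) x + (-1) ^ (k + p) * zetaSum i (k + p) x⁻¹)

theorem pair_add_ne {p : ℕ} {x : ℂ} (hp : 1 ≤ p) (h : (p, x) ≠ (1, 1)) (k : ℕ) :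
    (k + p, x) ≠ (1, 1) := by
  intro e
  obtain ⟨h1, rfl⟩ := Prod.mk.inj e
  exact h (by rw [show p = 1 by omega])

theorem coeff_reg_sub_psiExp {N i : ℕ} (hi : i < N) (p k : ℕ) (x : ℂ) :
    coeff k (reg (Finset.Icc 1 (N : ℤ)) p x (i + 1) - psiExp p x i)
      = (-1) ^ k * ((k + p - 1).choose (p - 1) : ℂ)
        * (zetaSum (N - (i + 1)) (k + p) x - Li (k + p) x) := by
  have e1 : (1 : ℤ) = ((i : ℤ) + 1) - i := by ring
  have e2 : (N : ℤ) = ((i : ℤ) + 1) + (N - (i + 1) : ℕ) := by omega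
  have : Finset.Icc 1 (N : ℤ) = Finset.Icc (((i : ℤ) + 1) - i) (((i : ℤ) + 1) + (N - (i + 1) : ℕ)) := by
    rw [← e1, ← e2]
  rw [map_sub, this, coeff_reg_Icc, psiExp, PowerSeries.coeff_mk]
  ring

theorem coeffIsBigO_reg_sub_psiExp {p : ℕ} {x : ℂ} (hx : ‖x‖ = 1) (hp : 1 ≤ p)
    (h : (p, x) ≠ (1, 1)) :
    CoeffIsBigO (𝓟 {t : ℕ × ℕ | t.2 < t.1})
      (fun t => reg (Finset.Icc 1 (t.1 : ℤ)) p x (t.2 + 1) - psiExp p x t.2)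
      (fun t => 1 / ((t.1 : ℝ) - t.2)) := by
  intro k
  obtain ⟨D, hD0, hD⟩ := exists_Li_sub_zetaSum_bound hx (by omega) (pair_add_ne hp h k)
  rw [isBigO_principal]
  refine ⟨((k + p - 1).choose (p - 1) : ℝ) * D, fun t ht => ?_⟩
  have ht' : t.2 < t.1 := ht
  rw [coeff_reg_sub_psiExp ht', norm_mul, norm_mul, norm_pow, norm_neg, norm_one, one_pow, one_mul,
    Complex.norm_natCast, mul_assoc]
  have e : (((t.1 - (t.2 + 1) : ℕ) : ℝ) + 1) = t.1 - t.2 := by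
    rw [Nat.cast_sub ht']; push_cast; ring
  have := hD (t.1 - (t.2 + 1))
  rw [e] at this
  have hpos : (0 : ℝ) < t.1 - t.2 := by rw [← e]; positivity
  rw [Real.norm_of_nonneg (by positivity), mul_one_div]
  gcongr

theorem coeffIsBigO_psiExp {p : ℕ} {x : ℂ} (hx : ‖x‖ = 1) (hp : 1 ≤ p)
    (h : (p, x) ≠ (1, 1)) (l : Filter (ℕ × ℕ)) :
    CoeffIsBigO l (fun t => psiExp p x t.2) (fun _ => 1) := by
  intro k
  obtain ⟨D, hD0, hD⟩ := exists_zetaSum_tail_bound (x := x⁻¹) (by simp [hx])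
    (show 1 ≤ k + p by omega) (pair_inv_ne (pair_add_ne hp h k))
  refine IsBigO.of_bound (((k + p - 1).choose (p - 1) : ℝ) * (‖Li (k + p) x‖ + D))
    (Eventually.of_forall fun t => ?_)
  simp only [psiExp, PowerSeries.coeff_mk]
  rw [norm_mul, norm_mul, norm_pow, norm_neg, norm_one, one_pow,
    one_mul, norm_one, mul_one, Complex.norm_natCast]
  gcongr
  refine (norm_add_le _ _).trans ?_
  rw [norm_mul, norm_pow, norm_neg, norm_one, one_pow, one_mul]
  gcongr
  have := hD 0 t.2
  simpa [zetaSum_zero] using this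

theorem coeffIsBigO_invPow {q : ℕ} (hq : 1 ≤ q) (l : Filter (ℕ × ℕ)) :
    CoeffIsBigO l (fun t => invPow (-((t.2 : ℂ) + 1 / 2)) q) (fun t => 1 / ((t.2 : ℝ) + 1)) := by
  intro k
  refine IsBigO.of_bound (((k + q - 1).choose (q - 1) : ℝ) * 2 ^ (k + q))
    (Eventually.of_forall fun t => ?_)
  have := norm_inv_half_pow_le (show 1 ≤ k + q by omega) t.2
  rw [norm_inv, norm_pow] at this
  rw [coeff_invPow, norm_div, norm_mul, norm_pow, norm_neg, norm_one, one_pow, one_mul, norm_pow,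
    norm_neg, Complex.norm_natCast, Real.norm_of_nonneg (by positivity), div_eq_mul_inv, mul_assoc,
    mul_one_div]
  gcongr

/-- Since 1/((N - i)(i + 1)) = (1/(N - i) + 1/(i + 1))/(N + 1), the sum is at most twice the Cesàro
mean of 1/(i + 1). -/
theorem tendsto_sum_one_div_mul_one_div :
    Tendsto (fun N : ℕ => ∑ i ∈ Finset.range N, 1 / ((N : ℝ) - i) * (1 / ((i : ℝ) + 1)))
      atTop (𝓝 0) := by
  have hc := (tendsto_one_div_add_atTop_nhds_zero_nat (𝕜 := ℝ)).cesaro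
  have hbound : ∀ N : ℕ, ∑ i ∈ Finset.range N, 1 / ((N : ℝ) - i) * (1 / ((i : ℝ) + 1))
      ≤ 2 * ((N : ℝ)⁻¹ * ∑ i ∈ Finset.range N, 1 / ((i : ℝ) + 1)) := by
    intro N
    have hrefl : ∑ i ∈ Finset.range N, 1 / ((N : ℝ) - i) = ∑ i ∈ Finset.range N, 1 / ((i : ℝ) + 1) := by
      rw [← Finset.sum_range_reflect]
      refine Finset.sum_congr rfl fun i hi => ?_
      have hi' := Finset.mem_range.1 hi
      congr 1
      rw [Nat.sub_sub, Nat.cast_sub (by omega)]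
      push_cast; ring
    calc _ ≤ ∑ i ∈ Finset.range N, (N : ℝ)⁻¹ * (1 / ((N : ℝ) - i) + 1 / ((i : ℝ) + 1)) := by
          refine Finset.sum_le_sum fun i hi => ?_
          have hi' : (i : ℝ) < N := by exact_mod_cast Finset.mem_range.1 hi
          have h0 : (0 : ℝ) < N - i := by linarith
          have h1 : (0 : ℝ) < (i : ℝ) + 1 := by positivity
          have hN : (0 : ℝ) < N := by linarith [(Nat.cast_nonneg i : (0 : ℝ) ≤ i)]
          rw [div_add_div _ _ h0.ne' h1.ne', div_mul_div_comm, inv_mul_eq_div, div_div,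
            div_le_div_iff₀ (by positivity) (by positivity)]
          nlinarith [mul_pos h0 h1]
      _ = _ := by
          rw [← Finset.mul_sum, Finset.sum_add_distrib, hrefl]; ring
  refine squeeze_zero (fun N => Finset.sum_nonneg fun i hi => ?_) hbound ?_
  · have hi' : (i : ℝ) < N := by exact_mod_cast Finset.mem_range.1 hi
    have h0 : (0 : ℝ) < N - i := by linarith
    positivity
  · simpa using hc.const_mul 2

/-- Completing ψ at -(i + 1) changes its coefficients by O(1/(N - i)), which is not small for i near
N; there the factor O(1/(i + 1)) from 1/(s + 1/2)^q compensates. -/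
theorem tendsto_sum_coeff_sub {w x₁ x₂ : ℂ} {p₁ p₂ q : ℕ} (hw : ‖w‖ = 1) (hx₁ : ‖x₁‖ = 1)
    (hx₂ : ‖x₂‖ = 1) (hp₁ : 1 ≤ p₁) (hp₂ : 1 ≤ p₂) (hq : 1 ≤ q) (h₁ : (p₁, x₁) ≠ (1, 1))
    (h₂ : (p₂, x₂) ≠ (1, 1)) (K : PowerSeries ℂ) (d : ℕ) :
    Tendsto (fun N => ∑ i ∈ Finset.range N, w ^ (i + 1) * coeff d
        (K * (1 + X ^ p₁ * reg (Finset.Icc 1 (N : ℤ)) p₁ x₁ (i + 1))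
          * (1 + X ^ p₂ * reg (Finset.Icc 1 (N : ℤ)) p₂ x₂ (i + 1)) * invPow (-(i + 1 / 2)) q)
      - ∑ i ∈ Finset.range N, w ^ (i + 1) * coeff d
        (K * (1 + X ^ p₁ * psiExp p₁ x₁ i) * (1 + X ^ p₂ * psiExp p₂ x₂ i)
          * invPow (-(i + 1 / 2)) q)) atTop (𝓝 0) := by
  set l : Filter (ℕ × ℕ) := 𝓟 {t : ℕ × ℕ | t.2 < t.1} with hl
  have d₁ := coeffIsBigO_reg_sub_psiExp hx₁ hp₁ h₁
  have d₂ := coeffIsBigO_reg_sub_psiExp hx₂ hp₂ h₂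
  have b₁ := coeffIsBigO_psiExp hx₁ hp₁ h₁ l
  have b₂ := coeffIsBigO_psiExp hx₂ hp₂ h₂ l
  have one_le : ∀ {f : ℕ × ℕ → PowerSeries ℂ}, CoeffIsBigO l f (fun t => 1 / ((t.1 : ℝ) - t.2)) →
      CoeffIsBigO l f (fun _ => 1) := by
    intro f hf k
    refine (hf k).trans ?_
    rw [hl, isBigO_principal]
    refine ⟨1, fun t ht => ?_⟩
    have ht' : (t.2 : ℝ) + 1 ≤ t.1 := by exact_mod_cast (show t.2 + 1 ≤ t.1 from ht)
    have h0 : (1 : ℝ) ≤ t.1 - t.2 := by linarith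
    rw [Real.norm_of_nonneg (by positivity), norm_one, one_mul, div_le_one (by positivity)]
    exact h0
  have r₂ : CoeffIsBigO l (fun t => 1 + X ^ p₂ * reg (Finset.Icc 1 (t.1 : ℤ)) p₂ x₂ (t.2 + 1))
      (fun _ => 1) := by
    refine (CoeffIsBigO.const l 1).add (CoeffIsBigO.const_mul _ ?_)
    simpa using (one_le d₂).add b₂
  have s₁ : CoeffIsBigO l (fun t => 1 + X ^ p₁ * psiExp p₁ x₁ t.2) (fun _ => 1) :=
    (CoeffIsBigO.const l 1).add (b₁.const_mul _)
  -- The difference of products is written as (a - a')b + (b - b')a', so that each summand contains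
  -- one small difference and one bounded factor.
  have hdiff := ((((d₁.const_mul (X ^ p₁)).mul_of_one r₂).add
    ((d₂.const_mul (X ^ p₂)).mul_of_one s₁)).const_mul K).mul (coeffIsBigO_invPow hq l)
  obtain ⟨D, hD⟩ := isBigO_principal.1 (hdiff d)
  refine squeeze_zero_norm (a := fun N : ℕ => D * ∑ i ∈ Finset.range N,
    1 / ((N : ℝ) - i) * (1 / ((i : ℝ) + 1))) (fun N => ?_)
    (by simpa using tendsto_sum_one_div_mul_one_div.const_mul D)
  rw [← Finset.sum_sub_distrib, Finset.mul_sum]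
  refine norm_sum_le_of_le _ fun i hi => ?_
  have hi' := Finset.mem_range.1 hi
  have hin : (i : ℝ) < N := by exact_mod_cast hi'
  have h0 : (0 : ℝ) < N - i := by linarith
  have := hD (N, i) hi'
  rw [Real.norm_of_nonneg (by positivity)] at this
  rw [← mul_sub, ← map_sub, norm_mul, norm_pow, hw, one_pow, one_mul]
  refine le_of_eq_of_le ?_ this
  congr 2
  ring

/-- The limit `N → ∞` of the residue identity. -/
theorem tendsto_sum_residues {x x₁ x₂ : ℂ} (hx : ‖x‖ = 1) (hx₁ : ‖x₁‖ = 1) (hx₂ : ‖x₂‖ = 1)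
    {p₁ p₂ q : ℕ} (hp₁ : 1 ≤ p₁) (hp₂ : 1 ≤ p₂) (hq : 1 ≤ q) (h₁ : (p₁, x₁) ≠ (1, 1))
    (h₂ : (p₂, x₂) ≠ (1, 1)) :
    Tendsto (fun N => ∑ i ∈ Finset.range N, (x * x₁ * x₂) ^ (i + 1) * coeff (p₁ + p₂)
        ((1 + X * kernelExp x) * (1 + X ^ p₁ * psiExp p₁ x₁ i) * (1 + X ^ p₂ * psiExp p₂ x₂ i)
          * invPow (-(i + 1 / 2)) q)
      + ∑ j ∈ Finset.range N, (x * x₁ * x₂)⁻¹ ^ j * ((Li p₁ x₁ - zetaSum j p₁ x₁)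
        * (Li p₂ x₂ - zetaSum j p₂ x₂) / (j + 1 / 2) ^ q)) atTop
      (𝓝 (-∑ k ∈ HasAntidiagonal.antidiagonal (q - 1), ∑ m ∈ HasAntidiagonal.antidiagonal k.1,
        ((-1) ^ m.1 * ti (m.1 + 1) x - x * ti (m.1 + 1) x⁻¹)
          * ((-1) ^ m.2 * ((m.2 + p₁ - 1).choose (p₁ - 1) : ℂ) * ti (m.2 + p₁) x₁)
          * ((-1) ^ k.2 * ((k.2 + p₂ - 1).choose (p₂ - 1) : ℂ) * ti (k.2 + p₂) x₂))) := by
  have hw : ‖x * x₁ * x₂‖ = 1 := by simp [hx, hx₁, hx₂]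
  obtain ⟨hsum, hpos⟩ := tendsto_tsum_posTerm (q := q) hw hx₁ hx₂ hp₁ hp₂ h₁ h₂
  have hneg := tendsto_tsum_negTerm hw hx₁ hx₂ hp₁ hp₂ hq h₁ h₂
  have hmid := tendsto_sum_coeff_sub hw hx₁ hx₂ hp₁ hp₂ hq h₁ h₂ (1 + X * kernelExp x) (p₁ + p₂)
  have hhalf : Tendsto (fun N : ℕ => coeff (q - 1) (kernelHalfExp x
        * halfExp (Finset.Icc 1 (N : ℤ)) p₁ x₁ * halfExp (Finset.Icc 1 (N : ℤ)) p₂ x₂)) atTop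
      (𝓝 (∑ k ∈ HasAntidiagonal.antidiagonal (q - 1), ∑ m ∈ HasAntidiagonal.antidiagonal k.1,
        ((-1) ^ m.1 * ti (m.1 + 1) x - x * ti (m.1 + 1) x⁻¹)
          * ((-1) ^ m.2 * ((m.2 + p₁ - 1).choose (p₁ - 1) : ℂ) * ti (m.2 + p₁) x₁)
          * ((-1) ^ k.2 * ((k.2 + p₂ - 1).choose (p₂ - 1) : ℂ) * ti (k.2 + p₂) x₂))) := by
    simp only [PowerSeries.coeff_mul, Finset.sum_mul, coeff_halfExp_Icc_one, kernelHalfExp,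
      PowerSeries.coeff_mk]
    refine tendsto_finsetSum _ fun k _ => tendsto_finsetSum _ fun m _ => ?_
    exact ((((tendsto_tSum hx₁ (by omega) (pair_add_ne hp₁ h₁ m.2)).const_mul _).const_mul _).mul
      ((tendsto_tSum hx₂ (by omega) (pair_add_ne hp₂ h₂ k.2)).const_mul _))
  -- The partial sums of the limiting series over s = j ≥ 0 and the full sums of `posTerm` have the
  -- same limit, so one may replace the other in the residue identity.
  have hlim := ((hsum.hasSum.tendsto_sum_nat.sub hpos).sub (hhalf.add (hneg.add hmid)))
  simp only [sub_self, add_zero, zero_sub] at hlim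
  refine hlim.congr fun N => ?_
  have := residue_identity N hx hx₁ hx₂ hp₁ hp₂ hq h₁ h₂
  linear_combination -this

/-! ### Expanding the residues into polylogarithms and Euler sums -/

theorem coeff_mul_eq_sum_range (d : ℕ) (f g : PowerSeries ℂ) :
    coeff d (f * g) = ∑ k ∈ Finset.range (d + 1), coeff k f * coeff (d - k) g := by
  rw [PowerSeries.coeff_mul, Finset.Nat.sum_antidiagonal_eq_sum_range_succ
    (fun i j => coeff i f * coeff j g)]

theorem coeff_add_residue_product {p₁ p₂ : ℕ} (hp₁ : 1 ≤ p₁) (hp₂ : 1 ≤ p₂)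
    (A F₁ F₂ G : PowerSeries ℂ) :
    coeff (p₁ + p₂) ((1 + X * A) * (1 + X ^ p₁ * F₁) * (1 + X ^ p₂ * F₂) * G)
      = coeff (p₁ + p₂) G
        + ∑ k ∈ Finset.range (p₂ + 1), coeff k F₁ * coeff (p₂ - k) G
        + ∑ k ∈ Finset.range (p₁ + 1), coeff k F₂ * coeff (p₁ - k) G
        + ∑ k ∈ Finset.range (p₁ + p₂), coeff k A * coeff (p₁ + p₂ - 1 - k) G
        + coeff 0 F₁ * coeff 0 F₂ * coeff 0 G
        + ∑ k₁ ∈ Finset.range p₂, ∑ k₂ ∈ Finset.range (p₂ - k₁),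
            coeff k₁ A * (coeff k₂ F₁ * coeff (p₂ - 1 - k₁ - k₂) G)
        + ∑ k₁ ∈ Finset.range p₁, ∑ k₂ ∈ Finset.range (p₁ - k₁),
            coeff k₁ A * (coeff k₂ F₂ * coeff (p₁ - 1 - k₁ - k₂) G) := by
  -- Eight terms; the last has order at least p₁ + p₂ + 1 and does not contribute, and the other
  -- seven yield the seven groups of the statement.
  have expand : (1 + X * A) * (1 + X ^ p₁ * F₁) * (1 + X ^ p₂ * F₂) * G
      = G + X ^ p₁ * (F₁ * G) + X ^ p₂ * (F₂ * G) + X ^ 1 * (A * G) + X ^ (p₁ + p₂) * (F₁ * F₂ * G)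
        + X ^ (p₁ + 1) * (A * (F₁ * G)) + X ^ (p₂ + 1) * (A * (F₂ * G))
        + X ^ (p₁ + p₂ + 1) * (A * F₁ * F₂ * G) := by ring
  have double : ∀ (p : ℕ), 1 ≤ p → ∀ F : PowerSeries ℂ, coeff (p - 1) (A * (F * G))
      = ∑ k₁ ∈ Finset.range p, ∑ k₂ ∈ Finset.range (p - k₁),
            coeff k₁ A * (coeff k₂ F * coeff (p - 1 - k₁ - k₂) G) := by
    intro p hp F
    rw [coeff_mul_eq_sum_range, Nat.sub_add_cancel hp]
    refine Finset.sum_congr rfl fun k₁ hk₁ => ?_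
    have := Finset.mem_range.1 hk₁
    rw [coeff_mul_eq_sum_range, Finset.mul_sum, show p - 1 - k₁ + 1 = p - k₁ by omega]
  rw [expand]
  simp only [map_add, PowerSeries.coeff_X_pow_mul']
  rw [if_pos (by omega), if_pos (by omega), if_pos (by omega), if_pos le_rfl, if_pos (by omega),
    if_pos (by omega), if_neg (by omega), Nat.add_sub_cancel_left, Nat.add_sub_cancel, Nat.sub_self,
    show p₁ + p₂ - (p₁ + 1) = p₂ - 1 by omega, show p₁ + p₂ - (p₂ + 1) = p₁ - 1 by omega,
    double p₂ hp₂, double p₁ hp₁, coeff_mul_eq_sum_range p₂, coeff_mul_eq_sum_range p₁,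
    coeff_mul_eq_sum_range (p₁ + p₂ - 1), Nat.sub_add_cancel (by omega)]
  simp only [PowerSeries.coeff_zero_eq_constantCoeff, map_mul]
  ring

theorem coeff_invPow_neg_half (i q l : ℕ) :
    coeff l (invPow (-((i : ℂ) + 1 / 2)) q)
      = (-1) ^ q * ((l + q - 1).choose (q - 1) : ℂ) / ((i : ℂ) + 1 / 2) ^ (l + q) := by
  have h : ((-1 : ℂ) ^ (l + q))⁻¹ = (-1) ^ (l + q) := by
    rw [← inv_pow]; norm_num
  have h2 : (-1 : ℂ) ^ l * (-1) ^ (l + q) = (-1) ^ q := by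
    rw [← pow_add, ← add_assoc, pow_add, ← two_mul, pow_mul]; norm_num
  rw [coeff_invPow, neg_pow _ (l + q), div_eq_mul_inv, mul_inv, h, div_eq_mul_inv]
  linear_combination ((l + q - 1).choose (q - 1) : ℂ) * (((i : ℂ) + 1 / 2) ^ (l + q))⁻¹ * h2

section

variable {w x : ℂ} {p q : ℕ}

theorem tendsto_sum_coeff_invPow (hw : ‖w‖ = 1) (hq : 1 ≤ q) (hqw : (q, w) ≠ (1, 1)) (l : ℕ) :
    Tendsto (fun N => ∑ i ∈ Finset.range N, w ^ (i + 1) * coeff l (invPow (-((i : ℂ) + 1 / 2)) q))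
      atTop (𝓝 ((-1) ^ q * (((l + q - 1).choose (q - 1) : ℂ) * ti (l + q) w))) := by
  refine (((tendsto_tSum hw (by omega) (pair_add_ne hq hqw l)).const_mul
    (((l + q - 1).choose (q - 1) : ℂ))).const_mul ((-1) ^ q)).congr fun N => ?_
  rw [tSum_eq_range, Finset.mul_sum, Finset.mul_sum]
  refine Finset.sum_congr rfl fun i _ => ?_
  rw [coeff_invPow_neg_half]
  ring

theorem tendsto_sum_zetaSum_div (hw : ‖w‖ = 1) (hx : ‖x‖ = 1) (hp : 1 ≤ p) (hpx : (p, x) ≠ (1, 1))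
    (hq : 1 ≤ q) (hqw : (q, w) ≠ (1, 1)) :
    Tendsto (fun N => ∑ n ∈ Finset.range N, zetaSum n p x / ((n : ℂ) + 1 / 2) ^ q * w ^ n) atTop
      (𝓝 (R₁ p x q w)) :=
  (RConverges_one hx hp hpx hw hq hqw).tendsto.congr fun _ => RPartial_one ..

theorem tendsto_sum_coeff_psiExp_mul (hw : ‖w‖ = 1) (hx : ‖x‖ = 1) (hp : 1 ≤ p)
    (hpx : (p, x) ≠ (1, 1)) (hq : 1 ≤ q) (hqw : (q, w) ≠ (1, 1)) (k l : ℕ) :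
    Tendsto (fun N => ∑ i ∈ Finset.range N, w ^ (i + 1) *
        (coeff k (psiExp p x i) * coeff l (invPow (-((i : ℂ) + 1 / 2)) q)))
      atTop (𝓝 ((-1) ^ q * w * (((k + p - 1).choose (p - 1) : ℂ) * ((l + q - 1).choose (q - 1) : ℂ)
        * (w⁻¹ * (-1) ^ k * Li (k + p) x * ti (l + q) w
          + (-1) ^ p * R₁ (k + p) x⁻¹ (l + q) w)))) := by
  have hw0 : w ≠ 0 := by rintro rfl; simp at hw
  have h1 := tendsto_tSum hw (by omega) (pair_add_ne hq hqw l)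
  have h2 := tendsto_sum_zetaSum_div (x := x⁻¹) hw (by simp [hx]) (by omega)
    (pair_inv_ne (pair_add_ne hp hpx k)) (by omega) (pair_add_ne hq hqw l)
  refine (((h1.const_mul (w⁻¹ * (-1) ^ k * Li (k + p) x)).add
    (h2.const_mul ((-1) ^ p))).const_mul
      (((k + p - 1).choose (p - 1) : ℂ) * ((l + q - 1).choose (q - 1) : ℂ))).const_mul
        ((-1) ^ q * w) |>.congr fun N => ?_
  rw [tSum_eq_range, Finset.mul_sum, Finset.mul_sum, ← Finset.sum_add_distrib, Finset.mul_sum,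
    Finset.mul_sum]
  refine Finset.sum_congr rfl fun i _ => ?_
  rw [coeff_invPow_neg_half, psiExp, PowerSeries.coeff_mk]
  have h2 : (-1 : ℂ) ^ k * (-1) ^ (k + p) = (-1) ^ p := by
    rw [← pow_add, ← add_assoc, pow_add, ← two_mul, pow_mul]; norm_num
  rw [← h2]
  field_simp
  ring

theorem tendsto_sum_psiExp_single (hw : ‖w‖ = 1) (hx : ‖x‖ = 1) (hp : 1 ≤ p)
    (hpx : (p, x) ≠ (1, 1)) (hq : 1 ≤ q) (hqw : (q, w) ≠ (1, 1)) (d : ℕ) :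
    Tendsto (fun N => ∑ i ∈ Finset.range N, w ^ (i + 1) * ∑ k ∈ Finset.range (d + 1),
        coeff k (psiExp p x i) * coeff (d - k) (invPow (-((i : ℂ) + 1 / 2)) q))
      atTop (𝓝 ((-1) ^ q * w * ∑ k ∈ Finset.range (d + 1), ((k + p - 1).choose (p - 1) : ℂ)
        * ((q + d - k - 1).choose (q - 1) : ℂ)
        * (w⁻¹ * (-1) ^ k * Li (k + p) x * ti (q + d - k) w
          + (-1) ^ p * R₁ (k + p) x⁻¹ (d + q - k) w))) := by
  simp only [Finset.mul_sum (s := Finset.range (d + 1))]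
  simp only [Finset.sum_comm (s := Finset.range _) (t := Finset.range (d + 1))]
  refine tendsto_finsetSum _ fun k hk => ?_
  have hk' := Finset.mem_range.1 hk
  have h := tendsto_sum_coeff_psiExp_mul hw hx hp hpx hq hqw k (d - k)
  rw [show d - k + q = q + d - k by omega] at h
  rw [show d + q - k = q + d - k by omega]
  exact h

theorem tendsto_sum_const_mul_invPow (hw : ‖w‖ = 1) (hq : 1 ≤ q) (hqw : (q, w) ≠ (1, 1))
    (a : ℕ → ℂ) (d : ℕ) :
    Tendsto (fun N => ∑ i ∈ Finset.range N, w ^ (i + 1) * ∑ k ∈ Finset.range d,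
        a k * coeff (d - 1 - k) (invPow (-((i : ℂ) + 1 / 2)) q))
      atTop (𝓝 ((-1) ^ q * ∑ k ∈ Finset.range d, ((q + d - k - 2).choose (q - 1) : ℂ) * a k
        * ti (q + d - k - 1) w)) := by
  simp only [Finset.mul_sum (s := Finset.range d)]
  simp only [Finset.sum_comm (s := Finset.range _) (t := Finset.range d)]
  refine tendsto_finsetSum _ fun k hk => ?_
  have hk' := Finset.mem_range.1 hk
  have h := (tendsto_sum_coeff_invPow hw hq hqw (d - 1 - k)).const_mul (a k)
  rw [show d - 1 - k + q - 1 = q + d - k - 2 by omega,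
    show d - 1 - k + q = q + d - k - 1 by omega] at h
  refine (h.congr fun N => ?_).trans_eq ?_
  · rw [Finset.mul_sum]
    exact Finset.sum_congr rfl fun i _ => by ring
  · congr 1; ring

theorem tendsto_sum_psiExp_double (hw : ‖w‖ = 1) (hx : ‖x‖ = 1) (hp : 1 ≤ p)
    (hpx : (p, x) ≠ (1, 1)) (hq : 1 ≤ q) (hqw : (q, w) ≠ (1, 1)) (a : ℕ → ℂ) (d : ℕ) :
    Tendsto (fun N => ∑ i ∈ Finset.range N, w ^ (i + 1) * ∑ k₁ ∈ Finset.range d,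
        ∑ k₂ ∈ Finset.range (d - k₁),
          a k₁ * (coeff k₂ (psiExp p x i) * coeff (d - 1 - k₁ - k₂) (invPow (-((i : ℂ) + 1 / 2)) q)))
      atTop (𝓝 ((-1) ^ q * w * ∑ k₁ ∈ Finset.range d, ∑ k₂ ∈ Finset.range (d - k₁),
        ((k₂ + p - 1).choose (p - 1) : ℂ) * ((q + d - k₁ - k₂ - 2).choose (q - 1) : ℂ) * a k₁
        * (w⁻¹ * (-1) ^ k₂ * Li (k₂ + p) x * ti (q + d - k₁ - k₂ - 1) w
          + (-1) ^ p * R₁ (k₂ + p) x⁻¹ (d + q - k₁ - k₂ - 1) w))) := by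
  have e : ∀ N, ∑ i ∈ Finset.range N, w ^ (i + 1) * ∑ k₁ ∈ Finset.range d,
        ∑ k₂ ∈ Finset.range (d - k₁),
          a k₁ * (coeff k₂ (psiExp p x i) * coeff (d - 1 - k₁ - k₂) (invPow (-((i : ℂ) + 1 / 2)) q))
      = ∑ k₁ ∈ Finset.range d, ∑ k₂ ∈ Finset.range (d - k₁), ∑ i ∈ Finset.range N, w ^ (i + 1) * (
          a k₁ * (coeff k₂ (psiExp p x i)
            * coeff (d - 1 - k₁ - k₂) (invPow (-((i : ℂ) + 1 / 2)) q))) := by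
    intro N
    simp only [Finset.mul_sum]
    rw [Finset.sum_comm]
    exact Finset.sum_congr rfl fun k₁ _ => Finset.sum_comm
  simp only [e]
  rw [Finset.mul_sum]
  refine tendsto_finsetSum _ fun k₁ hk₁ => ?_
  rw [Finset.mul_sum]
  refine tendsto_finsetSum _ fun k₂ hk₂ => ?_
  have hk₁' := Finset.mem_range.1 hk₁
  have hk₂' := Finset.mem_range.1 hk₂
  have h := (tendsto_sum_coeff_psiExp_mul hw hx hp hpx hq hqw k₂ (d - 1 - k₁ - k₂)).const_mul (a k₁)
  rw [show d - 1 - k₁ - k₂ + q - 1 = q + d - k₁ - k₂ - 2 by omega,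
    show d - 1 - k₁ - k₂ + q = q + d - k₁ - k₂ - 1 by omega] at h
  rw [show d + q - k₁ - k₂ - 1 = q + d - k₁ - k₂ - 1 by omega]
  refine (h.congr fun N => ?_).trans_eq ?_
  · rw [Finset.mul_sum]
    exact Finset.sum_congr rfl fun i _ => by ring
  · congr 1; ring

end

section

variable {w x₁ x₂ : ℂ} {p₁ p₂ q : ℕ}

theorem tendsto_sum_zetaSum_mul_div (hw : ‖w‖ = 1) (hx₁ : ‖x₁‖ = 1)
    (hx₂ : ‖x₂‖ = 1) (hp₁ : 1 ≤ p₁) (hp₂ : 1 ≤ p₂) (hq : 1 ≤ q) (h₁ : (p₁, x₁) ≠ (1, 1))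
    (h₂ : (p₂, x₂) ≠ (1, 1)) (hqw : (q, w) ≠ (1, 1)) :
    Tendsto (fun N => ∑ n ∈ Finset.range N,
      (zetaSum n p₁ x₁ * zetaSum n p₂ x₂) / ((n : ℂ) + 1 / 2) ^ q * w ^ n) atTop
      (𝓝 (R₂ p₁ p₂ x₁ x₂ q w)) :=
  (RConverges_two hx₁ hp₁ h₁ hx₂ hp₂ h₂ hw hq hqw).tendsto.congr fun _ => RPartial_two ..

/-- The quadratic expansion common to the residues at the positive and negative integers. -/
theorem tendsto_sum_affine_mul_affine (hw : ‖w‖ = 1) (hx₁ : ‖x₁‖ = 1)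
    (hx₂ : ‖x₂‖ = 1) (hp₁ : 1 ≤ p₁) (hp₂ : 1 ≤ p₂) (hq : 1 ≤ q) (h₁ : (p₁, x₁) ≠ (1, 1))
    (h₂ : (p₂, x₂) ≠ (1, 1)) (hqw : (q, w) ≠ (1, 1)) (a₁ a₂ b₁ b₂ : ℂ) :
    Tendsto (fun N => ∑ n ∈ Finset.range N, w ^ n *
      ((a₁ + b₁ * zetaSum n p₁ x₁) * (a₂ + b₂ * zetaSum n p₂ x₂) / ((n : ℂ) + 1 / 2) ^ q)) atTop
      (𝓝 (a₁ * a₂ * (w⁻¹ * ti q w) + a₁ * b₂ * R₁ p₂ x₂ q w + a₂ * b₁ * R₁ p₁ x₁ q w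
        + b₁ * b₂ * R₂ p₁ p₂ x₁ x₂ q w)) := by
  have hw0 : w ≠ 0 := by rintro rfl; simp at hw
  refine ((((((tendsto_tSum hw hq hqw).const_mul w⁻¹).const_mul (a₁ * a₂)).add
    ((tendsto_sum_zetaSum_div hw hx₂ hp₂ h₂ hq hqw).const_mul (a₁ * b₂))).add
    ((tendsto_sum_zetaSum_div hw hx₁ hp₁ h₁ hq hqw).const_mul (a₂ * b₁))).add
    ((tendsto_sum_zetaSum_mul_div hw hx₁ hx₂ hp₁ hp₂ hq h₁ h₂ hqw).const_mul
      (b₁ * b₂))).congr fun N => ?_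
  rw [tSum_eq_range]
  simp only [Finset.mul_sum]
  rw [← Finset.sum_add_distrib, ← Finset.sum_add_distrib, ← Finset.sum_add_distrib]
  refine Finset.sum_congr rfl fun n _ => ?_
  rw [pow_succ]
  field_simp
  ring

end

theorem sum_antidiagonalTuple_three (f : ℕ → ℕ → ℕ → ℂ) (n : ℕ) :
    ∑ k ∈ Finset.Nat.antidiagonalTuple 3 n, f (k 0) (k 1) (k 2)
      = ∑ k ∈ HasAntidiagonal.antidiagonal n, ∑ m ∈ HasAntidiagonal.antidiagonal k.1,
        f m.1 m.2 k.2 := by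
  rw [Finset.sum_sigma']
  refine Finset.sum_nbij' (fun k => ⟨(k 0 + k 1, k 2), (k 0, k 1)⟩)
    (fun k => ![k.2.1, k.2.2, k.1.2]) ?_ ?_ ?_ ?_ ?_
  · intro k hk
    rw [Finset.Nat.mem_antidiagonalTuple, Fin.sum_univ_three] at hk
    simp [hk]
  · rintro ⟨⟨a, b⟩, ⟨c, d⟩⟩ hk
    simp only [Finset.mem_sigma, HasAntidiagonal.mem_antidiagonal] at hk
    simp [Finset.Nat.mem_antidiagonalTuple, Fin.sum_univ_three, hk]
  · intro k _
    ext i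
    fin_cases i <;> rfl
  · rintro ⟨⟨a, b⟩, ⟨c, d⟩⟩ hk
    simp only [Finset.mem_sigma, HasAntidiagonal.mem_antidiagonal] at hk
    obtain ⟨h1, rfl⟩ := hk
    rfl
  · intro k _
    rfl

theorem sum_perm_fin_two (f : Equiv.Perm (Fin 2) → ℂ) :
    ∑ σ, f σ = f 1 + f (Equiv.swap 0 1) := by
  rw [show (Finset.univ : Finset (Equiv.Perm (Fin 2))) = {1, Equiv.swap 0 1} by decide,
    Finset.sum_pair (by decide)]

/-- Each of the seven groups converges separately, which is where (q, w) ≠ (1, 1) enters. The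
product of the two constant coefficients of the ψ's produces the quadratic sum at w. -/
theorem tendsto_sum_negative_residues {w x₁ x₂ : ℂ} {p₁ p₂ q : ℕ} (x : ℂ) (hw : ‖w‖ = 1)
    (hx₁ : ‖x₁‖ = 1) (hx₂ : ‖x₂‖ = 1) (hp₁ : 1 ≤ p₁) (hp₂ : 1 ≤ p₂) (hq : 1 ≤ q)
    (h₁ : (p₁, x₁) ≠ (1, 1)) (h₂ : (p₂, x₂) ≠ (1, 1)) (hqw : (q, w) ≠ (1, 1)) :
    Tendsto (fun N => ∑ i ∈ Finset.range N, w ^ (i + 1) * coeff (p₁ + p₂)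
        ((1 + X * kernelExp x) * (1 + X ^ p₁ * psiExp p₁ x₁ i) * (1 + X ^ p₂ * psiExp p₂ x₂ i)
          * invPow (-(i + 1 / 2)) q)) atTop
      (𝓝 ((-1) ^ q * (((q + p₁ + p₂ - 1).choose (q - 1) : ℂ) * ti (q + p₁ + p₂) w)
        + (-1) ^ q * w * (∑ k ∈ Finset.range (p₂ + 1), ((k + p₁ - 1).choose (p₁ - 1) : ℂ)
            * ((q + p₂ - k - 1).choose (q - 1) : ℂ)
            * (w⁻¹ * (-1) ^ k * Li (k + p₁) x₁ * ti (q + p₂ - k) w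
              + (-1) ^ p₁ * R₁ (k + p₁) x₁⁻¹ (p₂ + q - k) w))
        + (-1) ^ q * w * (∑ k ∈ Finset.range (p₁ + 1), ((k + p₂ - 1).choose (p₂ - 1) : ℂ)
            * ((q + p₁ - k - 1).choose (q - 1) : ℂ)
            * (w⁻¹ * (-1) ^ k * Li (k + p₂) x₂ * ti (q + p₁ - k) w
              + (-1) ^ p₂ * R₁ (k + p₂) x₂⁻¹ (p₁ + q - k) w))
        + (-1) ^ q * (∑ k ∈ Finset.range (p₁ + p₂), ((q + p₁ + p₂ - k - 2).choose (q - 1) : ℂ)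
            * ((-1) ^ k * Li (k + 1) x - Li (k + 1) x⁻¹) * ti (q + p₁ + p₂ - k - 1) w)
        + (-1) ^ q * w * (Li p₁ x₁ * Li p₂ x₂ * (w⁻¹ * ti q w)
            + Li p₁ x₁ * (-1) ^ p₂ * R₁ p₂ x₂⁻¹ q w + Li p₂ x₂ * (-1) ^ p₁ * R₁ p₁ x₁⁻¹ q w
            + (-1) ^ p₁ * (-1) ^ p₂ * R₂ p₁ p₂ x₁⁻¹ x₂⁻¹ q w)
        + (-1) ^ q * w * (∑ k₁ ∈ Finset.range p₂, ∑ k₂ ∈ Finset.range (p₂ - k₁),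
            ((k₂ + p₁ - 1).choose (p₁ - 1) : ℂ) * ((q + p₂ - k₁ - k₂ - 2).choose (q - 1) : ℂ)
            * ((-1) ^ k₁ * Li (k₁ + 1) x - Li (k₁ + 1) x⁻¹)
            * (w⁻¹ * (-1) ^ k₂ * Li (k₂ + p₁) x₁ * ti (q + p₂ - k₁ - k₂ - 1) w
              + (-1) ^ p₁ * R₁ (k₂ + p₁) x₁⁻¹ (p₂ + q - k₁ - k₂ - 1) w))
        + (-1) ^ q * w * (∑ k₁ ∈ Finset.range p₁, ∑ k₂ ∈ Finset.range (p₁ - k₁),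
            ((k₂ + p₂ - 1).choose (p₂ - 1) : ℂ) * ((q + p₁ - k₁ - k₂ - 2).choose (q - 1) : ℂ)
            * ((-1) ^ k₁ * Li (k₁ + 1) x - Li (k₁ + 1) x⁻¹)
            * (w⁻¹ * (-1) ^ k₂ * Li (k₂ + p₂) x₂ * ti (q + p₁ - k₁ - k₂ - 1) w
              + (-1) ^ p₂ * R₁ (k₂ + p₂) x₂⁻¹ (p₁ + q - k₁ - k₂ - 1) w)))) := by
  simp only [coeff_add_residue_product hp₁ hp₂, mul_add (_ ^ _), Finset.sum_add_distrib,
    kernelExp, PowerSeries.coeff_mk]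
  refine (((((Tendsto.add ?_ ?_).add ?_).add ?_).add ?_).add ?_).add ?_
  · have := tendsto_sum_coeff_invPow hw hq hqw (p₁ + p₂)
    rwa [show p₁ + p₂ + q = q + p₁ + p₂ by ring] at this
  · exact tendsto_sum_psiExp_single hw hx₁ hp₁ h₁ hq hqw p₂
  · exact tendsto_sum_psiExp_single hw hx₂ hp₂ h₂ hq hqw p₁
  · have := tendsto_sum_const_mul_invPow hw hq hqw
      (fun k => (-1) ^ k * Li (k + 1) x - Li (k + 1) x⁻¹) (p₁ + p₂)
    rwa [← add_assoc] at this
  · refine (((tendsto_sum_affine_mul_affine (x₁ := x₁⁻¹) (x₂ := x₂⁻¹) hw (by simp [hx₁])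
      (by simp [hx₂]) hp₁ hp₂ hq (pair_inv_ne h₁) (pair_inv_ne h₂) hqw (Li p₁ x₁) (Li p₂ x₂)
      ((-1) ^ p₁) ((-1) ^ p₂)).const_mul ((-1) ^ q * w)).congr fun N => ?_)
    rw [Finset.mul_sum]
    refine Finset.sum_congr rfl fun i _ => ?_
    rw [coeff_invPow_neg_half, psiExp, psiExp, PowerSeries.coeff_mk, PowerSeries.coeff_mk]
    simp only [zero_add, pow_zero, Nat.choose_self, Nat.cast_one, one_mul, mul_one]
    rw [pow_succ]
    ring
  · exact tendsto_sum_psiExp_double hw hx₁ hp₁ h₁ hq hqw _ p₂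
  · exact tendsto_sum_psiExp_double hw hx₂ hp₂ h₂ hq hqw _ p₁

end CyclotomicEuler
end

/-! ### The parity formula -/

open CyclotomicEuler
theorem mainTheorem4 (x : ℂ) (y : Fin 2 → ℂ) (p : Fin 2 → ℕ) (q : ℕ)
    (hx : IsOfFinOrder x) (hy : ∀ j, IsOfFinOrder (y j))
    (hp : ∀ j, 1 ≤ p j) (hq : 1 ≤ q)
    (hpy : ∀ j, (p j, y j) ≠ (1, 1))
    (w : ℂ) (hw : w = x * y 0 * y 1) (hqw : (q, w) ≠ (1, 1)) :
    -- all the `R`-series involved converge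
    RConverges ![p 0, p 1] ![y 0, y 1] q w⁻¹ ∧
    RConverges ![p 0, p 1] ![(y 0)⁻¹, (y 1)⁻¹] q w ∧
    (∀ j, RConverges ![p j] ![y j] q w⁻¹) ∧
    (∀ j a b, p j ≤ a → q ≤ b → RConverges ![a] ![(y j)⁻¹] b w) ∧
    -- the parity formula
    w⁻¹ * R₂ (p 0) (p 1) (y 0) (y 1) q w⁻¹
        + (-1) ^ (p 0 + p 1 + q) * R₂ (p 0) (p 1) (y 0)⁻¹ (y 1)⁻¹ q w
      = - Li (p 0) (y 0) * Li (p 1) (y 1) * ti q w⁻¹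
        + w⁻¹ * ∑ σ : Equiv.Perm (Fin 2),
            Li (p (σ 0)) (y (σ 0)) * R₁ (p (σ 1)) (y (σ 1)) q w⁻¹
        - (-1) ^ q * w⁻¹ * ((q + p 0 + p 1 - 1).choose (q - 1) : ℂ) * ti (q + p 0 + p 1) w
        - (-1) ^ q * ∑ σ : Equiv.Perm (Fin 2), ∑ k ∈ Finset.range (p (σ 0) + 1),
            ((k + p (σ 1) - 1).choose (p (σ 1) - 1) : ℂ)
              * ((q + p (σ 0) - k - 1).choose (q - 1) : ℂ)
              * (w⁻¹ * (-1) ^ k * Li (k + p (σ 1)) (y (σ 1)) * ti (q + p (σ 0) - k) w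
                + (-1) ^ p (σ 1) * R₁ (k + p (σ 1)) (y (σ 1))⁻¹ (p (σ 0) + q - k) w)
        - (-1) ^ q * w⁻¹ * ∑ k ∈ Finset.range (p 0 + p 1),
            ((q + p 0 + p 1 - k - 2).choose (q - 1) : ℂ)
              * ((-1) ^ k * Li (k + 1) x - Li (k + 1) x⁻¹)
              * ti (q + p 0 + p 1 - k - 1) w
        - (-1) ^ q * w⁻¹ * Li (p 0) (y 0) * Li (p 1) (y 1) * ti q w
        - (-1) ^ q * ∑ σ : Equiv.Perm (Fin 2),
            (-1) ^ p (σ 1) * Li (p (σ 0)) (y (σ 0)) * R₁ (p (σ 1)) (y (σ 1))⁻¹ q w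
        - (-1) ^ q * ∑ σ : Equiv.Perm (Fin 2),
            ∑ k₁ ∈ Finset.range (p (σ 0)), ∑ k₂ ∈ Finset.range (p (σ 0) - k₁),
              ((k₂ + p (σ 1) - 1).choose (p (σ 1) - 1) : ℂ)
                * ((q + p (σ 0) - k₁ - k₂ - 2).choose (q - 1) : ℂ)
                * ((-1) ^ k₁ * Li (k₁ + 1) x - Li (k₁ + 1) x⁻¹)
                * (w⁻¹ * (-1) ^ k₂ * Li (k₂ + p (σ 1)) (y (σ 1))
                      * ti (q + p (σ 0) - k₁ - k₂ - 1) w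
                  + (-1) ^ p (σ 1)
                      * R₁ (k₂ + p (σ 1)) (y (σ 1))⁻¹ (p (σ 0) + q - k₁ - k₂ - 1) w)
        - ∑ k ∈ Finset.Nat.antidiagonalTuple 3 (q - 1),
            ((-1) ^ k 0 * ti (k 0 + 1) x - x * ti (k 0 + 1) x⁻¹)
              * (-1) ^ (k 1 + k 2)
              * ((k 1 + p 0 - 1).choose (p 0 - 1) : ℂ)
              * ((k 2 + p 1 - 1).choose (p 1 - 1) : ℂ)
              * w⁻¹ * ti (k 1 + p 0) (y 0) * ti (k 2 + p 1) (y 1) := by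
  have hx1 : ‖x‖ = 1 := hx.norm_eq_one
  have hy1 : ∀ j, ‖y j‖ = 1 := fun j => (hy j).norm_eq_one
  have hw1 : ‖w‖ = 1 := by rw [hw]; simp [hx1, hy1]
  have hw0 : w ≠ 0 := by rintro rfl; simp at hw1
  have hwi : ‖w⁻¹‖ = 1 := by simp [hw1]
  have hyi : ∀ j, ‖(y j)⁻¹‖ = 1 := fun j => by simp [hy1]
  have hqwi := pair_inv_ne hqw
  refine ⟨RConverges_two (hy1 0) (hp 0) (hpy 0) (hy1 1) (hp 1) (hpy 1) hwi hq hqwi,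
    RConverges_two (hyi 0) (hp 0) (pair_inv_ne (hpy 0)) (hyi 1) (hp 1) (pair_inv_ne (hpy 1)) hw1 hq
      hqw,
    fun j => RConverges_one (hy1 j) (hp j) (hpy j) hwi hq hqwi,
    fun j a b ha hb => ?_, ?_⟩
  · obtain ⟨a, rfl⟩ := Nat.exists_eq_add_of_le' ha
    obtain ⟨b, rfl⟩ := Nat.exists_eq_add_of_le' hb
    have := hp j
    exact RConverges_one (hyi j) (by omega) (pair_inv_ne (pair_add_ne (hp j) (hpy j) a)) hw1
      (by omega) (pair_add_ne hq hqw b)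
  have hres := tendsto_sum_residues hx1 (hy1 0) (hy1 1) (hp 0) (hp 1) hq (hpy 0) (hpy 1)
  rw [← hw] at hres
  have hneg := tendsto_sum_negative_residues x hw1 (hy1 0) (hy1 1) (hp 0) (hp 1) hq (hpy 0) (hpy 1)
    hqw
  -- The tails Li − ζ_n are affine in ζ_n with slope -1, so the quadratic sum at w⁻¹ appears with
  -- coefficient (-1)(-1) = 1.
  have hpos := tendsto_sum_affine_mul_affine hwi (hy1 0) (hy1 1) (hp 0) (hp 1) hq (hpy 0) (hpy 1)
    hqwi (Li (p 0) (y 0)) (Li (p 1) (y 1)) (-1) (-1)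
  have hpos' := hpos.congr (f₂ := fun N => ∑ j ∈ Finset.range N, w⁻¹ ^ j *
      ((Li (p 0) (y 0) - zetaSum j (p 0) (y 0)) * (Li (p 1) (y 1) - zetaSum j (p 1) (y 1))
        / (j + 1 / 2) ^ q)) (fun N => Finset.sum_congr rfl fun j _ => by ring)
  have key := tendsto_nhds_unique hres (hneg.add hpos')
  have hlast : ∑ k ∈ Finset.Nat.antidiagonalTuple 3 (q - 1),
            ((-1) ^ k 0 * ti (k 0 + 1) x - x * ti (k 0 + 1) x⁻¹)
              * (-1) ^ (k 1 + k 2)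
              * ((k 1 + p 0 - 1).choose (p 0 - 1) : ℂ)
              * ((k 2 + p 1 - 1).choose (p 1 - 1) : ℂ)
              * w⁻¹ * ti (k 1 + p 0) (y 0) * ti (k 2 + p 1) (y 1)
      = w⁻¹ * ∑ k ∈ HasAntidiagonal.antidiagonal (q - 1), ∑ m ∈ HasAntidiagonal.antidiagonal k.1,
        ((-1) ^ m.1 * ti (m.1 + 1) x - x * ti (m.1 + 1) x⁻¹)
          * ((-1) ^ m.2 * ((m.2 + p 0 - 1).choose (p 0 - 1) : ℂ) * ti (m.2 + p 0) (y 0))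
          * ((-1) ^ k.2 * ((k.2 + p 1 - 1).choose (p 1 - 1) : ℂ) * ti (k.2 + p 1) (y 1)) := by
    rw [← sum_antidiagonalTuple_three (fun a b c => ((-1) ^ a * ti (a + 1) x - x * ti (a + 1) x⁻¹)
          * ((-1) ^ b * ((b + p 0 - 1).choose (p 0 - 1) : ℂ) * ti (b + p 0) (y 0))
          * ((-1) ^ c * ((c + p 1 - 1).choose (p 1 - 1) : ℂ) * ti (c + p 1) (y 1))),
      Finset.mul_sum]
    refine Finset.sum_congr rfl fun k _ => ?_
    ring
  rw [hlast]
  simp only [sum_perm_fin_two, Equiv.Perm.coe_one, id_eq, Equiv.swap_apply_left,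
    Equiv.swap_apply_right]
  rw [inv_inv] at key
  generalize (∑ k ∈ HasAntidiagonal.antidiagonal (q - 1), _ : ℂ) = S at key ⊢
  generalize (∑ k ∈ Finset.range (p 0 + 1), _ : ℂ) = S₁ at key ⊢
  generalize (∑ k ∈ Finset.range (p 1 + 1), _ : ℂ) = S₂ at key ⊢
  generalize (∑ k ∈ Finset.range (p 0 + p 1), _ : ℂ) = S₃ at key ⊢
  generalize (∑ k ∈ Finset.range (p 0), _ : ℂ) = S₄ at key ⊢
  generalize (∑ k ∈ Finset.range (p 1), _ : ℂ) = S₅ at key ⊢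
  have hww : w⁻¹ * w = 1 := inv_mul_cancel₀ hw0
  -- The limit identity is the formula up to the factor -w; the second part cancels w⁻¹ w in the
  -- terms that carry a factor w.
  linear_combination -w⁻¹ * key - (Li (p 0) (y 0) * Li (p 1) (y 1) * ti q w⁻¹
    + (-1) ^ q * (S₁ + S₂ + S₄ + S₅ + (Li (p 0) (y 0) * Li (p 1) (y 1) * (w⁻¹ * ti q w)
      + Li (p 0) (y 0) * (-1) ^ p 1 * R₁ (p 1) (y 1)⁻¹ q w
      + Li (p 1) (y 1) * (-1) ^ p 0 * R₁ (p 0) (y 0)⁻¹ q w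
      + (-1) ^ p 0 * (-1) ^ p 1 * R₂ (p 0) (p 1) (y 0)⁻¹ (y 1)⁻¹ q w))) * hww
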